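/- **Theorem 5 (generalized dressing cosets, gauge symmetry).** Let $D$ be a finite-dimensional real Lie group whose Lie algebra ${\cal D}$ carries a non-degenerate symmetric invariant bilinear form $\langle\cdot|\cdot\rangle$ and is the direct sum of two isotropic Lie subalgebras ${\cal G}$ and $\hat{\cal G}$, with projections $J:{\cal D}\to{\cal G}$ and $\hat J:{\cal D}\to\hat{\cal G}$ along the other summand. Let $R:\mathrm{Dom} R\to{\cal G}$ and $\hat R:\mathrm{Dom}\hat R\to\hat{\cal G}$ be linear operators on subspaces $\mathrm{Dom} R\subset\hat{\cal G}$, $\mathrm{Dom}\hat R\subset{\cal G}$, and let $R^*:\mathrm{Dom}R^*\to{\cal G}$ and $\hat R^*:\mathrm{Dom}\hat R^*\to\hat{\cal G}$, with $\mathrm{Dom}R^*\subset\hat{\cal G}$, $\mathrm{Dom}\hat R^*\subset{\cal G}$, be linear operators adjoint to them, i.e. $\langle R^*x|y\rangle=\langle x|Ry\rangle$ for $x\in\mathrm{Dom}R^*$, $y\in\mathrm{Dom}R$, and likewise for $\hat R^*$. Assume 1. $\mathrm{Ker} R=\mathrm{Ker} R^*$ and $\mathrm{Ker}\hat R=\mathrm{Ker}\hat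 R^*$; 2. $(R|_{\mathrm{Im}\hat R})^{-1}=\hat R|_{\mathrm{Im}R}$; 3. $\mathrm{Dom}R$ is the annihilator of $\mathrm{Ker}\hat R$ in $\hat{\cal G}$, and $\mathrm{Dom}\hat R$ is the annihilator of $\mathrm{Ker}R$ in ${\cal G}$; 4. $\mathrm{Im}\hat R\subset\mathrm{Dom}R$ and $\mathrm{Im}R\subset\mathrm{Dom}\hat R$; 5. $\mathrm{Dom}R=\mathrm{Dom}R^*$ and $\mathrm{Dom}\hat R=\mathrm{Dom}\hat R^*$; 6. $\langle\cdot|\cdot\rangle$ is non-degenerate on $\mathrm{Im}R\oplus\mathrm{Im}\hat R$. Put ${\cal R}=\mathrm{Ker}\hat R\oplus\{\gamma+R\gamma:\gamma\in\mathrm{Dom}R\}$, ${\cal R}^\perp=\mathrm{Ker}\hat R\oplus\{\gamma-R^*\gamma:\gamma\in\mathrm{Dom}R^*\}$ and ${\cal F}={\cal R}\cap{\cal R}^\perp$. Assume that ${\cal F}$ is a Lie subalgebra of ${\cal D}$, let $F\subset D$ be a connected Lie subgroup with Lie algebra ${\cal F}$, and assume that for all $f\in F$ $$J\mathrm{Ad}_f\hat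 J+J[\mathrm{Ad}_f,R]\hat J=R\,\mathrm{Ad}_fR \ \text{ on } \mathrm{Dom}R,\qquad \hat J\mathrm{Ad}_fJ+\hat J[\mathrm{Ad}_f,\hat R]J=\hat R\,\mathrm{Ad}_f\hat R\ \text{ on }\mathrm{Dom}\hat R,$$ where $R$ and $\hat R$ act on elements of ${\cal D}$ through $R\hat J$ and $\hat RJ$; it is part of the hypothesis that all terms are defined, i.e. that $\hat J\mathrm{Ad}_f\gamma$ and $\hat J\mathrm{Ad}_fR\gamma$ lie in $\mathrm{Dom}R$ for $\gamma\in\mathrm{Dom}R$, and similarly for $\hat R$. Then the following holds. (a) $\mathrm{Ad}_f\,\mathrm{Ker}R\subset\mathrm{Ker}R$ and $\mathrm{Ad}_f\,\mathrm{Ker}\hat R\subset\mathrm{Ker}\hat R$ for all $f\in F$. (b) Every $X\in{\cal F}^\perp$ can be written as $X=\alpha_++\alpha_-+R\alpha_+-R^*\alpha_-+\alpha_0$ with $\alpha_\pm\in\mathrm{Dom}R$ and $\alpha_0\in\mathrm{Ker}\hat R$, and $K(X)=2\langle\alpha_+|R\alpha_+\rangle+2\langle\alpha_-|R\alpha_-\rangle$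 does not depend on the choice of such a decomposition. (c) Let the world-sheet be an open set $U\subset\mathbb{R}^2$ with coordinates $(\tau,\sigma)$, let $B$ be any smooth 2-form on $D$ with $dB=\langle\theta\wedge[\theta\wedge\theta]\rangle$, where $\theta=dg\,g^{-1}$ is the right-invariant Maurer-Cartan form (the 3-form takes the value $6\langle\theta(X)|[\theta(Y),\theta(Z)]\rangle$ on $X,Y,Z$), and for smooth fields $l:U\to D$ and $\Lambda:U\to{\cal F}$ let $${\cal S}_W(l,\Lambda)=\int_W\Big(\tfrac12\langle\partial_\tau ll^{-1}|\partial_\sigma ll^{-1}\rangle+\tfrac1{12}(l^*B)(\partial_\sigma,\partial_\tau)+\tfrac12K(\partial_\sigma ll^{-1})+\langle\Lambda|\partial_\sigma ll^{-1}\rangle\Big)d\tau d\sigma$$ be the first-order action over a compact set $W\subset U$. Let $f:U\to F$ be a gauge transformation supported in $W$ and connected to the identity, i.e. a field which can be deformed smoothly to the constant field $1$ through $F$-valued fields equal to $1$ outside $W$. Under $$l\mapsto l'=fl,\qquad \Lambda\mapsto\Lambda'=f\Lambda f^{-1}-\partial_\tau ff^{-1},$$ $\Lambda'$ is again ${\cal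 F}$-valued, and the constraint $\partial_\sigma ll^{-1}\in{\cal F}^\perp$ is equivalent at each point to $\partial_\sigma l'l'^{-1}\in{\cal F}^\perp$. If $\partial_\sigma ll^{-1}\in{\cal F}^\perp$ on $U$, then ${\cal S}_W(l',\Lambda')={\cal S}_W(l,\Lambda)$. For all $l$ and $\Lambda$, with or without the constraint, the same equality holds for the action without the term $K$. The integrands are integrable on $W$ in all these cases. -/

import Mathlib

open scoped Manifold ContDiff
open MeasureTheory

noncomputable section

namespace DressingCosets

/-- Over `ℝ` the order of smoothness that Mathlib requires for the Lie algebra structure of a Lie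
group is `3`, so every smooth Lie group qualifies. -/
instance instLEInftyMinSmoothness : ENat.LEInfty (minSmoothness ℝ 3) :=
  ⟨by simpa using (ENat.LEInfty.out : (3 : WithTop ℕ∞) ≤ ∞)⟩

/-! ### Linear algebra: partially defined operators on a space with a bilinear form -/

section LinearAlgebra

variable {V : Type*} [AddCommGroup V] [Module ℝ V]

/-- The kernel `{x ∈ Dom R | R x = 0}` of a partially defined linear operator. -/
def opKer (R : V →ₗ.[ℝ] V) : Submodule ℝ V :=
  (LinearMap.ker R.toFun).map R.domain.subtype

/-- The image `{R x | x ∈ Dom R}` of a partially defined linear operator. -/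
def opIm (R : V →ₗ.[ℝ] V) : Submodule ℝ V :=
  LinearMap.range R.toFun

/-- The standing hypotheses on the operators `R : Dom R ⊆ 𝒢' → 𝒢` and `R' : Dom R' ⊆ 𝒢 → 𝒢'` and
on their adjoints `Rs` and `Rs'` with respect to the bilinear form; here `𝒢'` and `R'` are the dual
subalgebra and the dual operator. -/
structure OperatorHypotheses (form : LinearMap.BilinForm ℝ V) (𝒢 𝒢' : Submodule ℝ V)
    (R Rs R' Rs' : V →ₗ.[ℝ] V) : Prop where
  dom_le : R.domain ≤ 𝒢'
  im_le : opIm R ≤ 𝒢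
  dom_le_adj : Rs.domain ≤ 𝒢'
  im_le_adj : opIm Rs ≤ 𝒢
  dom_le' : R'.domain ≤ 𝒢
  im_le' : opIm R' ≤ 𝒢'
  dom_le_adj' : Rs'.domain ≤ 𝒢
  im_le_adj' : opIm Rs' ≤ 𝒢'
  /-- `Rs` is adjoint to `R`. -/
  adjoint : ∀ (x : Rs.domain) (y : R.domain), form (Rs x) y = form x (R y)
  /-- `Rs'` is adjoint to `R'`. -/
  adjoint' : ∀ (x : Rs'.domain) (y : R'.domain), form (Rs' x) y = form x (R' y)
  /-- `Ker R = Ker R^*`. -/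
  ker_eq : opKer R = opKer Rs
  ker_eq' : opKer R' = opKer Rs'
  /-- `Im R' ⊆ Dom R` and `Im R ⊆ Dom R'`. -/
  im_le_dom : opIm R' ≤ R.domain
  im_le_dom' : opIm R ≤ R'.domain
  /-- The restrictions `R : Im R' → Im R` and `R' : Im R → Im R'` are inverse to each other. -/
  left_inv : ∀ x : R.domain, (x : V) ∈ opIm R' → ∀ y : R'.domain, (y : V) = R x → R' y = x
  right_inv : ∀ y : R'.domain, (y : V) ∈ opIm R → ∀ x : R.domain, (x : V) = R' y → R x = y
  /-- `Dom R` is the annihilator of `Ker R'` in `𝒢'`. -/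
  dom_eq_annihilator : ∀ x : V, x ∈ R.domain ↔ x ∈ 𝒢' ∧ ∀ k ∈ opKer R', form k x = 0
  /-- `Dom R'` is the annihilator of `Ker R` in `𝒢`. -/
  dom_eq_annihilator' : ∀ x : V, x ∈ R'.domain ↔ x ∈ 𝒢 ∧ ∀ k ∈ opKer R, form k x = 0
  /-- `Dom R = Dom R^*`. -/
  dom_eq : R.domain = Rs.domain
  dom_eq' : R'.domain = Rs'.domain
  /-- The form is nondegenerate on `Im R ⊕ Im R'`. -/
  nondegenerate : ∀ x ∈ opIm R ⊔ opIm R', (∀ y ∈ opIm R ⊔ opIm R', form x y = 0) → x = 0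

/-- The subspace `Ker R' ⊕ {γ + R γ | γ ∈ Dom R}`. -/
def spaceR (R R' : V →ₗ.[ℝ] V) : Submodule ℝ V :=
  opKer R' ⊔ LinearMap.range (R.domain.subtype + R.toFun)

/-- The subspace `Ker R' ⊕ {γ - R^* γ | γ ∈ Dom R^*}`. -/
def spaceRPerp (Rs R' : V →ₗ.[ℝ] V) : Submodule ℝ V :=
  opKer R' ⊔ LinearMap.range (Rs.domain.subtype - Rs.toFun)

/-- The subspace `ℱ`, the intersection of the two preceding ones. -/
def spaceF (R Rs R' : V →ₗ.[ℝ] V) : Submodule ℝ V :=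
  spaceR R R' ⊓ spaceRPerp Rs R'

/-- `X = α₊ + α₋ + R α₊ - R^* α₋ + α₀` with `α₊, α₋ ∈ Dom R = Dom R^*` and `α₀ ∈ Ker R'`. -/
def IsDecomposition (R Rs R' : V →ₗ.[ℝ] V) (X : V) (αp αm : R.domain) : Prop :=
  ∃ αm' : Rs.domain, (αm' : V) = αm ∧ ∃ α₀ ∈ opKer R', X = αp + αm + R αp - Rs αm' + α₀

open Classical in
/-- The quadratic form `K(X) = 2⟨α₊ | R α₊⟩ + 2⟨α₋ | R α₋⟩`, where `X` is decomposed as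
`α₊ + α₋ + R α₊ - R^* α₋ + α₀`. Only its values on `ℱ^⊥`, where such decompositions exist, matter;
elsewhere it is given the value `0`. -/
def quadK (form : LinearMap.BilinForm ℝ V) (R Rs R' : V →ₗ.[ℝ] V) (X : V) : ℝ :=
  if h : ∃ α : R.domain × R.domain, IsDecomposition R Rs R' X α.1 α.2 then
    2 * form h.choose.1 (R h.choose.1) + 2 * form h.choose.2 (R h.choose.2)
  else 0

/-- The identity `J Ad Ĵ + J [Ad, R] Ĵ = R Ad R` on `Dom R`, for a given linear map `Ad`; `J` and
`J'` are the projections onto the algebra containing `Im R` and the one containing `Dom R`. An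
operator `R` with `Dom R` inside the range of `J'` acts on the whole space as `R J'`, so the
elements to which `R` is applied have to lie in its domain. -/
def IntertwiningIdentity (J J' : V →ₗ[ℝ] V) (R : V →ₗ.[ℝ] V) (Ad : V →ₗ[ℝ] V) : Prop :=
  ∀ γ : R.domain, ∃ (h₁ : J' (Ad γ) ∈ R.domain) (h₂ : J' (Ad (R γ)) ∈ R.domain),
    J (Ad γ) + (J (Ad (R γ)) - J (R ⟨J' (Ad γ), h₁⟩)) = R ⟨J' (Ad (R γ)), h₂⟩

end LinearAlgebra

/-! ### Lie groups -/

section LieGroups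

variable {E : Type*} [NormedAddCommGroup E] [NormedSpace ℝ E]
  {D : Type*} [TopologicalSpace D] [ChartedSpace E D] [Group D]

variable (E) in
/-- The adjoint action `Ad_g` of a Lie group on its Lie algebra: the derivative at `1` of the
conjugation by `g`. -/
def Ad (g : D) : GroupLieAlgebra 𝓘(ℝ, E) D →L[ℝ] GroupLieAlgebra 𝓘(ℝ, E) D :=
  mfderiv 𝓘(ℝ, E) 𝓘(ℝ, E) (fun y : D => g * y * g⁻¹) 1

variable (E) in
/-- The pull-back `du u⁻¹` at `x` of the right-invariant Maurer-Cartan form by a map `u` from a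
normed space to a Lie group: the derivative at `x` of `y ↦ u y * (u x)⁻¹`. -/
def rightLogDeriv {S : Type*} [NormedAddCommGroup S] [NormedSpace ℝ S] (u : S → D) (x : S) :
    S →L[ℝ] GroupLieAlgebra 𝓘(ℝ, E) D :=
  mfderiv 𝓘(ℝ, S) 𝓘(ℝ, E) (fun y : S => u y * (u x)⁻¹) x

variable (E) in
/-- `∂_τ u u⁻¹` at a point `x = (τ, σ)` of the world-sheet. -/
def dτ (u : ℝ × ℝ → D) (x : ℝ × ℝ) : GroupLieAlgebra 𝓘(ℝ, E) D :=
  rightLogDeriv E u x (1, 0)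

variable (E) in
/-- `∂_σ u u⁻¹` at a point `x = (τ, σ)` of the world-sheet. -/
def dσ (u : ℝ × ℝ → D) (x : ℝ × ℝ) : GroupLieAlgebra 𝓘(ℝ, E) D :=
  rightLogDeriv E u x (0, 1)

/-- The Lie algebra of `D` with the bilinear form and the subalgebras `𝒢`, `𝒢'` is the Lie algebra
of a Drinfeld double: the form is symmetric, nondegenerate and invariant, and the subalgebras are
complementary and isotropic. -/
structure IsDrinfeldDouble [LieGroup 𝓘(ℝ, E) ∞ D] [CompleteSpace E]
    (form : LinearMap.BilinForm ℝ (GroupLieAlgebra 𝓘(ℝ, E) D))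
    (𝒢 𝒢' : LieSubalgebra ℝ (GroupLieAlgebra 𝓘(ℝ, E) D)) : Prop where
  symm : ∀ X Y, form X Y = form Y X
  nondegenerate : form.Nondegenerate
  invariant_Ad : ∀ (g : D) X Y, form (Ad E g X) (Ad E g Y) = form X Y
  invariant_ad : ∀ X Y Z, form ⁅X, Y⁆ Z = form X ⁅Y, Z⁆
  isCompl : IsCompl 𝒢.toSubmodule 𝒢'.toSubmodule
  isotropic : ∀ X ∈ 𝒢, ∀ Y ∈ 𝒢, form X Y = 0
  isotropic' : ∀ X ∈ 𝒢', ∀ Y ∈ 𝒢', form X Y = 0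

/-- A smooth 2-form `B` on `D` with `dB = ⟨θ ∧ [θ ∧ θ]⟩`, where `θ` is the right-invariant
Maurer-Cartan form; the 3-form `⟨θ ∧ [θ ∧ θ]⟩` takes the value `6 ⟨θ X, [θ Y, θ Z]⟩` on `X, Y, Z`.
The 2-form is given in the right trivialization of the tangent bundle:
`B_g (X, Y) = b g (θ X, θ Y)`. The equality of 3-forms is tested on the pull-backs by all smooth
maps from open sets of a three-dimensional space. -/
def IsWZPrimitive (form : LinearMap.BilinForm ℝ (GroupLieAlgebra 𝓘(ℝ, E) D))
    (b : D → E [⋀^Fin 2]→L[ℝ] ℝ) : Prop :=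
  ContMDiff 𝓘(ℝ, E) 𝓘(ℝ, E [⋀^Fin 2]→L[ℝ] ℝ) ∞ b ∧
  ∀ (O : Set (ℝ × ℝ × ℝ)) (u : ℝ × ℝ × ℝ → D), IsOpen O →
    ContMDiffOn 𝓘(ℝ, ℝ × ℝ × ℝ) 𝓘(ℝ, E) ∞ u O →
    ∀ y ∈ O, ∀ v : Fin 3 → ℝ × ℝ × ℝ,
      extDeriv (fun z => (b (u z)).compContinuousLinearMap
        (rightLogDeriv E u z : ℝ × ℝ × ℝ →L[ℝ] E)) y v =
      6 * form (rightLogDeriv E u y (v 0)) ⁅rightLogDeriv E u y (v 1), rightLogDeriv E u y (v 2)⁆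

/-- The density with respect to `dτ dσ` of the first-order action at a point of the world-sheet,
for the field `l` and the Lagrange multiplier `Λ`. The world-sheet is oriented by `dσ ∧ dτ`. -/
def lagrangian (form : LinearMap.BilinForm ℝ (GroupLieAlgebra 𝓘(ℝ, E) D))
    (b : D → E [⋀^Fin 2]→L[ℝ] ℝ) (K : GroupLieAlgebra 𝓘(ℝ, E) D → ℝ)
    (l : ℝ × ℝ → D) (Λ : ℝ × ℝ → GroupLieAlgebra 𝓘(ℝ, E) D) (x : ℝ × ℝ) : ℝ :=
  1 / 2 * form (dτ E l x) (dσ E l x) + 1 / 12 * b (l x) ![dσ E l x, dτ E l x]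
    + 1 / 2 * K (dσ E l x) + form (Λ x) (dσ E l x)

/-- The first-order action over a part `W` of the world-sheet. -/
def action (form : LinearMap.BilinForm ℝ (GroupLieAlgebra 𝓘(ℝ, E) D))
    (b : D → E [⋀^Fin 2]→L[ℝ] ℝ) (K : GroupLieAlgebra 𝓘(ℝ, E) D → ℝ) (W : Set (ℝ × ℝ))
    (l : ℝ × ℝ → D) (Λ : ℝ × ℝ → GroupLieAlgebra 𝓘(ℝ, E) D) : ℝ :=
  ∫ x in W, lagrangian form b K l Λ x

variable {E₁ : Type*} [NormedAddCommGroup E₁] [NormedSpace ℝ E₁]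
  {F : Type*} [TopologicalSpace F] [ChartedSpace E₁ F] [Group F]

/-- The homomorphism `ι : F → D` makes `F` a (not necessarily embedded) Lie subgroup of `D` with
Lie algebra `ℱ`: it is smooth, it is an injective immersion, and the range of its derivative at `1`
is `ℱ`. -/
structure IsLieSubgroup (ι : F →* D) (ℱ : Submodule ℝ (GroupLieAlgebra 𝓘(ℝ, E) D)) : Prop where
  smooth : ContMDiff 𝓘(ℝ, E₁) 𝓘(ℝ, E) ∞ ι
  injective : Function.Injective ι
  immersive : Function.Injective (mfderiv 𝓘(ℝ, E₁) 𝓘(ℝ, E) ι 1)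
  range_deriv : ∀ X : GroupLieAlgebra 𝓘(ℝ, E) D,
    X ∈ ℱ ↔ ∃ Y : GroupLieAlgebra 𝓘(ℝ, E₁) F, mfderiv 𝓘(ℝ, E₁) 𝓘(ℝ, E) ι 1 Y = X

/-- A gauge transformation on the world-sheet `U` supported in `W ⊆ U`: an `F`-valued field that
can be deformed smoothly to the constant `1`, through fields that are `1` outside `W`. -/
def IsGaugeTransformation (U W : Set (ℝ × ℝ)) (f : ℝ × ℝ → F) : Prop :=
  ∃ h : ℝ × (ℝ × ℝ) → F,
    ContMDiffOn 𝓘(ℝ, ℝ × (ℝ × ℝ)) 𝓘(ℝ, E₁) ∞ h (Set.univ ×ˢ U) ∧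
    (∀ x ∈ U, h (0, x) = 1) ∧ (∀ x ∈ U, h (1, x) = f x) ∧
    ∀ s, ∀ x ∈ U \ W, h (s, x) = 1

/-- The gauge transform `f l` of the field `l`. -/
def gaugeField (ι : F →* D) (f : ℝ × ℝ → F) (l : ℝ × ℝ → D) : ℝ × ℝ → D :=
  fun x => ι (f x) * l x

/-- The gauge transform `f Λ f⁻¹ - ∂_τ f f⁻¹` of the Lagrange multiplier `Λ`. -/
def gaugeMultiplier (ι : F →* D) (f : ℝ × ℝ → F) (Λ : ℝ × ℝ → GroupLieAlgebra 𝓘(ℝ, E) D) :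
    ℝ × ℝ → GroupLieAlgebra 𝓘(ℝ, E) D :=
  fun x => Ad E (ι (f x)) (Λ x) - dτ E (fun y => ι (f y)) x

end LieGroups

end DressingCosets

end

/-! On `ℱ^⊥ = ℛ + ℛ^⊥` the form `K` is given by `K(p + q) = ⟨p|p⟩ - ⟨q|q⟩` for `p ∈ ℛ`, `q ∈ ℛ^⊥`,
which is independent of the decomposition because `ℛ ⊥ ℛ^⊥`. The intertwining identities say that
`Ad_f` maps `γ + Rγ` to a vector of the same shape. By duality `Ad_f` then preserves
`Ker R ⊕ Ker R'`, hence each kernel, hence `ℛ` and `ℛ^⊥`, so that `K (Y + Ad_f X) = K X`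
for `Y ∈ ℱ`.

For a deformation `h_s` of the gauge transformation put `u = h l`, so that `∂_s u u⁻¹ = ∂_s h h⁻¹`
lies in the isotropic subalgebra `ℱ`. The Maurer-Cartan equation for `du u⁻¹` and for `dh h⁻¹`, in
which the bracket terms cancel against the exterior derivative of the primitive `B`, makes the
`s`-derivative of the gauge-transformed density a divergence in `(τ, σ)` of quantities that are
linear in `∂_s h h⁻¹`. These vanish outside `W`, so the action does not depend on `s`. -/

noncomputable section

namespace DressingCosets

section Subspaces

variable {𝕜 V : Type*} [Field 𝕜] [AddCommGroup V] [Module 𝕜 V] {form : LinearMap.BilinForm 𝕜 V}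

theorem orthogonal_sup (P Q : Submodule 𝕜 V) :
    form.orthogonal (P ⊔ Q) = form.orthogonal P ⊓ form.orthogonal Q := by
  refine le_antisymm (le_inf (LinearMap.BilinForm.orthogonal_le le_sup_left)
    (LinearMap.BilinForm.orthogonal_le le_sup_right)) ?_
  rintro X ⟨hP, hQ⟩ Y hY
  obtain ⟨p, hp, q, hq, rfl⟩ := Submodule.mem_sup.1 hY
  exact (form.add_left p q X).trans (by rw [hP p hp, hQ q hq, add_zero])

theorem orthogonal_inf [FiniteDimensional 𝕜 V] (hn : form.Nondegenerate) (hr : form.IsRefl)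
    (P Q : Submodule 𝕜 V) :
    form.orthogonal (P ⊓ Q) = form.orthogonal P ⊔ form.orthogonal Q := by
  rw [← LinearMap.BilinForm.orthogonal_orthogonal hn hr (form.orthogonal P ⊔ form.orthogonal Q),
    orthogonal_sup, LinearMap.BilinForm.orthogonal_orthogonal hn hr,
    LinearMap.BilinForm.orthogonal_orthogonal hn hr]

theorem map_mem_orthogonal {A B : V →ₗ[𝕜] V} (hBA : form.IsAdjointPair form B A)
    {P : Submodule 𝕜 V} (hB : ∀ Y ∈ P, B Y ∈ P) {X : V} (hX : X ∈ form.orthogonal P) :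
    A X ∈ form.orthogonal P := fun Y hY =>
  (hBA Y X).symm.trans (hX _ (hB Y hY))

theorem map_mem_orthogonal_iff {A B : V →ₗ[𝕜] V} (hBA : form.IsAdjointPair form B A)
    {P : Submodule 𝕜 V} (hinv : ∀ X, B (A X) = X) (hA : ∀ Y ∈ P, A Y ∈ P) (hB : ∀ Y ∈ P, B Y ∈ P)
    {X : V} : A X ∈ form.orthogonal P ↔ X ∈ form.orthogonal P := by
  refine ⟨fun hX Y hY => ?_, map_mem_orthogonal hBA hB⟩
  have h : form (B (A Y)) X = 0 := (hBA (A Y) X).trans (hX _ (hA Y hY))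
  rwa [hinv] at h

theorem form_self_sub_form_self {P Q : Submodule 𝕜 V} (hsymm : ∀ X Y, form X Y = form Y X)
    (hPQ : ∀ p ∈ P, ∀ q ∈ Q, form p q = 0) {p q p' q' : V} (hp : p ∈ P) (hq : q ∈ Q) (hp' : p' ∈ P)
    (hq' : q' ∈ Q) (h : p + q = p' + q') :
    form p p - form q q = form p' p' - form q' q' := by
  have form_add_sub : ∀ x ∈ P, ∀ y ∈ Q, form (x + y) (x - y) = form x x - form y y := by
    intro x hx y hy
    simp only [map_add, map_sub, LinearMap.add_apply, hPQ x hx y hy, hsymm y x]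
    ring
  have hd : p - p' = q' - q := by rw [sub_eq_sub_iff_add_eq_add, h, add_comm]
  have hdQ : p - p' ∈ Q := hd ▸ sub_mem hq' hq
  have hpd : form p (p - p') = 0 := hPQ p hp _ hdQ
  have hqd : form q (p - p') = 0 := by rw [hsymm, hPQ _ (sub_mem hp hp') q hq]
  have hsub : p - q = p' - q' + (2 : 𝕜) • (p - p') := by
    rw [two_smul]
    nth_rewrite 2 [hd]
    abel
  rw [← form_add_sub p hp q hq, ← form_add_sub p' hp' q' hq', ← h, hsub, map_add, map_smul,
    LinearMap.BilinForm.add_left _ _ (p - p'), hpd, hqd, add_zero, smul_zero, add_zero]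

theorem exists_linearMap_add_eq (P Q : Submodule 𝕜 V) :
    ∃ (p : (P ⊔ Q : Submodule 𝕜 V) →ₗ[𝕜] V) (q : (P ⊔ Q : Submodule 𝕜 V) →ₗ[𝕜] V),
      ∀ x, p x ∈ P ∧ q x ∈ Q ∧ p x + q x = x := by
  let T : P × Q →ₗ[𝕜] (P ⊔ Q : Submodule 𝕜 V) :=
    (P.subtype.coprod Q.subtype).codRestrict _ fun x => Submodule.add_mem_sup x.1.2 x.2.2
  have hT : LinearMap.range T = ⊤ := by
    rw [LinearMap.range_eq_top]
    rintro ⟨x, hx⟩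
    obtain ⟨p, hp, q, hq, rfl⟩ := Submodule.mem_sup.1 hx
    exact ⟨(⟨p, hp⟩, ⟨q, hq⟩), rfl⟩
  obtain ⟨S, hS⟩ := T.exists_rightInverse_of_surjective hT
  exact ⟨P.subtype ∘ₗ LinearMap.fst 𝕜 P Q ∘ₗ S, Q.subtype ∘ₗ LinearMap.snd 𝕜 P Q ∘ₗ S,
    fun x => ⟨(S x).1.2, (S x).2.2, congrArg Subtype.val (LinearMap.congr_fun hS x)⟩⟩

end Subspaces

section Operators

variable {V : Type*} [AddCommGroup V] [Module ℝ V]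

theorem mem_opKer {R : V →ₗ.[ℝ] V} {X : V} :
    X ∈ opKer R ↔ ∃ h : X ∈ R.domain, R ⟨X, h⟩ = 0 :=
  ⟨fun ⟨y, hy, e⟩ => e ▸ ⟨y.2, hy⟩, fun ⟨h, h0⟩ => ⟨⟨X, h⟩, h0, rfl⟩⟩

theorem apply_mem_opIm (R : V →ₗ.[ℝ] V) (x : R.domain) : R x ∈ opIm R := ⟨x, rfl⟩

theorem mem_spaceR {R R' : V →ₗ.[ℝ] V} {X : V} :
    X ∈ spaceR R R' ↔ ∃ k ∈ opKer R', ∃ γ : R.domain, X = k + (γ + R γ) := by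
  rw [spaceR, Submodule.mem_sup]
  exact ⟨fun ⟨k, hk, _, ⟨γ, rfl⟩, e⟩ => ⟨k, hk, γ, e.symm⟩,
    fun ⟨k, hk, γ, e⟩ => ⟨k, hk, _, ⟨γ, rfl⟩, e.symm⟩⟩

theorem mem_spaceRPerp {Rs R' : V →ₗ.[ℝ] V} {X : V} :
    X ∈ spaceRPerp Rs R' ↔ ∃ k ∈ opKer R', ∃ γ : Rs.domain, X = k + (γ - Rs γ) := by
  rw [spaceRPerp, Submodule.mem_sup]
  exact ⟨fun ⟨k, hk, _, ⟨γ, rfl⟩, e⟩ => ⟨k, hk, γ, e.symm⟩,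
    fun ⟨k, hk, γ, e⟩ => ⟨k, hk, _, ⟨γ, rfl⟩, e.symm⟩⟩

theorem add_apply_mem_spaceR {R R' : V →ₗ.[ℝ] V} (γ : R.domain) : (γ : V) + R γ ∈ spaceR R R' :=
  mem_spaceR.2 ⟨0, zero_mem _, γ, (zero_add _).symm⟩

theorem sub_apply_mem_spaceRPerp {Rs R' : V →ₗ.[ℝ] V} (γ : Rs.domain) :
    (γ : V) - Rs γ ∈ spaceRPerp Rs R' :=
  mem_spaceRPerp.2 ⟨0, zero_mem _, γ, (zero_add _).symm⟩

theorem opKer_le_spaceR {R R' : V →ₗ.[ℝ] V} : opKer R' ≤ spaceR R R' := le_sup_left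

/-- Two complementary isotropic subspaces of a space with a nondegenerate symmetric bilinear form:
the linear algebra that underlies a Drinfeld double. -/
structure IsLagrangianPair (form : LinearMap.BilinForm ℝ V) (G G' : Submodule ℝ V) : Prop where
  symm : ∀ X Y, form X Y = form Y X
  nondegenerate : form.Nondegenerate
  isCompl : IsCompl G G'
  isotropic : ∀ X ∈ G, ∀ Y ∈ G, form X Y = 0
  isotropic' : ∀ X ∈ G', ∀ Y ∈ G', form X Y = 0

variable {form : LinearMap.BilinForm ℝ V} {G G' : Submodule ℝ V}

namespace IsLagrangianPair

theorem swap (hD : IsLagrangianPair form G G') : IsLagrangianPair form G' G :=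
  ⟨hD.symm, hD.nondegenerate, hD.isCompl.symm, hD.isotropic', hD.isotropic⟩

theorem isRefl (hD : IsLagrangianPair form G G') : form.IsRefl := fun x y h => by
  rw [hD.symm, h]

theorem exists_add (hD : IsLagrangianPair form G G') (X : V) : ∃ g ∈ G, ∃ g' ∈ G', g + g' = X :=
  Submodule.mem_sup.1 (hD.isCompl.sup_eq_top ▸ Submodule.mem_top)

theorem orthogonal_orthogonal [FiniteDimensional ℝ V] (hD : IsLagrangianPair form G G')
    (P : Submodule ℝ V) : form.orthogonal (form.orthogonal P) = P :=
  LinearMap.BilinForm.orthogonal_orthogonal hD.nondegenerate hD.isRefl P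

end IsLagrangianPair

variable {R Rs R' Rs' : V →ₗ.[ℝ] V}

namespace OperatorHypotheses

theorem swap (hR : OperatorHypotheses form G G' R Rs R' Rs') :
    OperatorHypotheses form G' G R' Rs' R Rs where
  dom_le := hR.dom_le'
  im_le := hR.im_le'
  dom_le_adj := hR.dom_le_adj'
  im_le_adj := hR.im_le_adj'
  dom_le' := hR.dom_le
  im_le' := hR.im_le
  dom_le_adj' := hR.dom_le_adj
  im_le_adj' := hR.im_le_adj
  adjoint := hR.adjoint'
  adjoint' := hR.adjoint
  ker_eq := hR.ker_eq'
  ker_eq' := hR.ker_eq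
  im_le_dom := hR.im_le_dom'
  im_le_dom' := hR.im_le_dom
  left_inv := hR.right_inv
  right_inv := hR.left_inv
  dom_eq_annihilator := hR.dom_eq_annihilator'
  dom_eq_annihilator' := hR.dom_eq_annihilator
  dom_eq := hR.dom_eq'
  dom_eq' := hR.dom_eq
  nondegenerate := sup_comm (opIm R) (opIm R') ▸ hR.nondegenerate

variable (hR : OperatorHypotheses form G G' R Rs R' Rs')

include hR

theorem opKer_le : opKer R ≤ G' := fun _ hx => hR.dom_le (mem_opKer.1 hx).1

theorem apply_mem (γ : R.domain) : R γ ∈ G := hR.im_le (apply_mem_opIm R γ)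

theorem adjoint_apply_mem (γ : Rs.domain) : Rs γ ∈ G := hR.im_le_adj (apply_mem_opIm Rs γ)

theorem coe_mem_domain (γ : Rs.domain) : (γ : V) ∈ R.domain := hR.dom_eq.ge γ.2

theorem exists_opKer_add_apply (x : R.domain) :
    ∃ k : R.domain, R k = 0 ∧ ∃ y : R'.domain, (x : V) = k + R' y := by
  let y : R'.domain := ⟨R x, hR.im_le_dom' (apply_mem_opIm R x)⟩
  let z : R.domain := ⟨R' y, hR.im_le_dom (apply_mem_opIm R' y)⟩
  have hz : R z = R x := hR.right_inv y (apply_mem_opIm R x) z rfl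
  exact ⟨x - z, by rw [R.map_sub, hz, sub_self], y, (sub_add_cancel (x : V) z).symm⟩

variable (hD : IsLagrangianPair form G G')

include hD

theorem orthogonal_opKer' : form.orthogonal (opKer R') = G ⊔ R.domain := by
  ext X
  obtain ⟨g, hg, g', hg', rfl⟩ := hD.exists_add X
  have hkg : ∀ k ∈ opKer R', form k (g + g') = form k g' := fun k hk => by
    rw [map_add, hD.isotropic k (hR.swap.opKer_le hk) g hg, zero_add]
  constructor
  · intro hX
    refine Submodule.add_mem_sup hg ((hR.dom_eq_annihilator g').2 ⟨hg', fun k hk => ?_⟩)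
    exact (hkg k hk).symm.trans (hX k hk)
  · intro hX k hk
    obtain ⟨x, hx, γ, hγ, e⟩ := Submodule.mem_sup.1 hX
    change form k (g + g') = 0
    rw [← e, map_add, hD.isotropic k (hR.swap.opKer_le hk) x hx,
      ((hR.dom_eq_annihilator γ).1 hγ).2 k hk, add_zero]

theorem opKer'_eq_orthogonal [FiniteDimensional ℝ V] :
    opKer R' = form.orthogonal (G ⊔ R.domain) := by
  rw [← hR.orthogonal_opKer' hD, hD.orthogonal_orthogonal]

theorem orthogonal_opKer_sup_opKer :
    form.orthogonal (opKer R ⊔ opKer R') = R.domain ⊔ R'.domain := by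
  rw [orthogonal_sup, hR.orthogonal_opKer' hD, hR.swap.orthogonal_opKer' hD.swap, sup_comm G',
    sup_inf_assoc_of_le _ (hR.dom_le'.trans le_sup_left), ← inf_sup_assoc_of_le _ hR.dom_le,
    hD.isCompl.symm.inf_eq_bot, bot_sup_eq, sup_comm]

theorem form_spaceR_spaceRPerp {X Y : V} (hX : X ∈ spaceR R R') (hY : Y ∈ spaceRPerp Rs R') :
    form X Y = 0 := by
  obtain ⟨k, hk, γ, rfl⟩ := mem_spaceR.1 hX
  obtain ⟨k', hk', γ', rfl⟩ := mem_spaceRPerp.1 hY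
  have hk_domain : ∀ k ∈ opKer R', ∀ γ ∈ R.domain, form k γ = 0 := fun k hk γ hγ =>
    ((hR.dom_eq_annihilator γ).1 hγ).2 k hk
  have hkG := hR.swap.opKer_le hk
  have hkG' := hR.swap.opKer_le hk'
  have hγ' := hR.coe_mem_domain γ'
  have hadj : form γ (Rs γ') = form (R γ) γ' := by rw [hD.symm, hR.adjoint, hD.symm]
  simp only [map_add, map_sub, LinearMap.add_apply, hadj, hD.symm γ k',
    hD.isotropic k hkG k' hkG', hD.isotropic k hkG _ (hR.adjoint_apply_mem γ'),
    hD.isotropic _ (hR.apply_mem γ) k' hkG',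
    hD.isotropic _ (hR.apply_mem γ) _ (hR.adjoint_apply_mem γ'),
    hD.isotropic' γ (hR.dom_le γ.2) γ' (hR.dom_le hγ'),
    hk_domain k hk γ' hγ', hk_domain k' hk' γ γ.2]
  ring

theorem spaceF_isotropic {X Y : V} (hX : X ∈ spaceF R Rs R') (hY : Y ∈ spaceF R Rs R') :
    form X Y = 0 :=
  hR.form_spaceR_spaceRPerp hD hX.1 hY.2

variable [FiniteDimensional ℝ V]

theorem orthogonal_spaceR : form.orthogonal (spaceR R R') = spaceRPerp Rs R' := by
  refine le_antisymm (fun X hX => ?_) fun Y hY X hX => hR.form_spaceR_spaceRPerp hD hX hY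
  have hX' : X ∈ G ⊔ R.domain := by
    rw [← hR.orthogonal_opKer' hD]
    exact LinearMap.BilinForm.orthogonal_le opKer_le_spaceR hX
  obtain ⟨g, hg, x, hx, rfl⟩ := Submodule.mem_sup.1 hX'
  let γ : Rs.domain := ⟨x, hR.dom_eq ▸ hx⟩
  have hkG : g + Rs γ ∈ G := add_mem hg (hR.adjoint_apply_mem γ)
  have hk : g + Rs γ ∈ opKer R' := by
    rw [hR.opKer'_eq_orthogonal hD, orthogonal_sup]
    refine ⟨fun z hz => hD.isotropic z hz _ hkG, fun z hz => ?_⟩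
    let δ : R.domain := ⟨z, hz⟩
    have hδX : form (z + R δ) (g + x) = 0 := hX _ (add_apply_mem_spaceR δ)
    have hδγ : form (z + R δ) (x - Rs γ) = 0 :=
      hR.form_spaceR_spaceRPerp hD (add_apply_mem_spaceR (R' := R') δ) (sub_apply_mem_spaceRPerp γ)
    have hRδ : form (R δ) (g + Rs γ) = 0 := hD.isotropic _ (hR.apply_mem δ) _ hkG
    calc form z (g + Rs γ)
        = form (z + R δ) (g + x) - form (z + R δ) (x - Rs γ) - form (R δ) (g + Rs γ) := by
          simp only [map_add, map_sub, LinearMap.add_apply]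
          ring
      _ = 0 := by rw [hδX, hδγ, hRδ, sub_zero, sub_zero]
  exact mem_spaceRPerp.2 ⟨_, hk, γ, by rw [add_add_sub_cancel]⟩

theorem map_mem_spaceRPerp {A B : V →ₗ[ℝ] V} (hBA : form.IsAdjointPair form B A)
    (hB : ∀ X ∈ spaceR R R', B X ∈ spaceR R R') {X : V} (hX : X ∈ spaceRPerp Rs R') :
    A X ∈ spaceRPerp Rs R' := by
  rw [← hR.orthogonal_spaceR hD] at hX ⊢
  exact map_mem_orthogonal hBA hB hX

theorem orthogonal_spaceF :
    form.orthogonal (spaceF R Rs R') = spaceR R R' ⊔ spaceRPerp Rs R' := by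
  rw [spaceF, orthogonal_inf hD.nondegenerate hD.isRefl, hR.orthogonal_spaceR hD,
    ← hR.orthogonal_spaceR hD, hD.orthogonal_orthogonal, sup_comm]

end OperatorHypotheses

end Operators

section QuadraticForm

variable {V : Type*} [AddCommGroup V] [Module ℝ V] {form : LinearMap.BilinForm ℝ V}
  {G G' : Submodule ℝ V} {R Rs R' Rs' : V →ₗ.[ℝ] V}

namespace OperatorHypotheses

variable (hR : OperatorHypotheses form G G' R Rs R' Rs')

include hR

theorem exists_isDecomposition_add {p q : V} (hp : p ∈ spaceR R R') (hq : q ∈ spaceRPerp Rs R') :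
    ∃ αp αm : R.domain, IsDecomposition R Rs R' (p + q) αp αm := by
  obtain ⟨k, hk, γ, rfl⟩ := mem_spaceR.1 hp
  obtain ⟨k', hk', γ', rfl⟩ := mem_spaceRPerp.1 hq
  refine ⟨γ, ⟨γ', hR.coe_mem_domain γ'⟩, γ', rfl, k + k', add_mem hk hk', ?_⟩
  simp only
  abel

variable (hD : IsLagrangianPair form G G')

include hD

theorem form_self_add_apply (γ : R.domain) : form (γ + R γ) (γ + R γ) = 2 * form γ (R γ) := by
  simp only [map_add, LinearMap.add_apply, hD.symm (R γ) γ,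
    hD.isotropic' γ (hR.dom_le γ.2) γ (hR.dom_le γ.2),
    hD.isotropic _ (hR.apply_mem γ) _ (hR.apply_mem γ)]
  ring

theorem form_self_sub_adjoint_apply (γ : Rs.domain) (α : R.domain) (h : (γ : V) = α) :
    form (γ - Rs γ) (γ - Rs γ) = -(2 * form α (R α)) := by
  have hadj : form (Rs γ) γ = form α (R α) := by rw [h, hR.adjoint, h]
  simp only [map_sub, LinearMap.sub_apply, hD.symm γ (Rs γ), hadj,
    hD.isotropic' γ (hR.dom_le_adj γ.2) γ (hR.dom_le_adj γ.2),
    hD.isotropic _ (hR.adjoint_apply_mem γ) _ (hR.adjoint_apply_mem γ)]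
  ring

theorem exists_add_of_isDecomposition {X : V} {αp αm : R.domain}
    (h : IsDecomposition R Rs R' X αp αm) :
    ∃ p ∈ spaceR R R', ∃ q ∈ spaceRPerp Rs R', p + q = X ∧
      form p p - form q q = 2 * form αp (R αp) + 2 * form αm (R αm) := by
  obtain ⟨αm', hαm, k, hk, rfl⟩ := h
  have hq := sub_apply_mem_spaceRPerp (R' := R') αm'
  have hkk : form k k = 0 :=
    hD.isotropic k (hR.swap.opKer_le hk) k (hR.swap.opKer_le hk)
  have hkq : form k (αm' - Rs αm') = 0 := hR.form_spaceR_spaceRPerp hD (opKer_le_spaceR hk) hq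
  refine ⟨αp + R αp, add_apply_mem_spaceR αp, k + (αm' - Rs αm'),
    mem_spaceRPerp.2 ⟨k, hk, αm', rfl⟩, by rw [hαm]; abel, ?_⟩
  rw [hR.form_self_add_apply hD, form.add_left, map_add (form k), map_add (form (αm' - Rs αm')),
    hkk, hkq, hD.symm _ k, hkq, hR.form_self_sub_adjoint_apply hD αm' αm hαm]
  ring

theorem quadK_add {p q : V} (hp : p ∈ spaceR R R') (hq : q ∈ spaceRPerp Rs R') :
    quadK form R Rs R' (p + q) = form p p - form q q := by
  have hex : ∃ α : R.domain × R.domain, IsDecomposition R Rs R' (p + q) α.1 α.2 :=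
    let ⟨αp, αm, h⟩ := hR.exists_isDecomposition_add hp hq
    ⟨(αp, αm), h⟩
  obtain ⟨p', hp', q', hq', hadd, hform⟩ := hR.exists_add_of_isDecomposition hD hex.choose_spec
  rw [quadK, dif_pos hex, ← hform]
  exact form_self_sub_form_self hD.symm
    (fun _ h _ h' => hR.form_spaceR_spaceRPerp hD h h') hp' hq' hp hq hadd

theorem quadK_eq_of_isDecomposition {X : V} {αp αm : R.domain}
    (h : IsDecomposition R Rs R' X αp αm) :
    quadK form R Rs R' X = 2 * form αp (R αp) + 2 * form αm (R αm) := by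
  obtain ⟨p, hp, q, hq, rfl, hform⟩ := hR.exists_add_of_isDecomposition hD h
  rw [hR.quadK_add hD hp hq, hform]

theorem quadK_add_map {A : V →ₗ[ℝ] V} (hA : ∀ X Y, form (A X) (A Y) = form X Y)
    (hAR : ∀ X ∈ spaceR R R', A X ∈ spaceR R R')
    (hAP : ∀ X ∈ spaceRPerp Rs R', A X ∈ spaceRPerp Rs R')
    {X Y : V} (hX : X ∈ spaceR R R' ⊔ spaceRPerp Rs R') (hY : Y ∈ spaceF R Rs R') :
    quadK form R Rs R' (Y + A X) = quadK form R Rs R' X := by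
  obtain ⟨p, hp, q, hq, rfl⟩ := Submodule.mem_sup.1 hX
  have hpY : form (A p) Y = 0 := hR.form_spaceR_spaceRPerp hD (hAR p hp) hY.2
  rw [hR.quadK_add hD hp hq, map_add, ← add_assoc,
    hR.quadK_add hD (add_mem hY.1 (hAR p hp)) (hAP q hq), hA, form.add_left, map_add, map_add, hA,
    hR.spaceF_isotropic hD hY hY, hD.symm Y, hpY, zero_add, zero_add, zero_add]

theorem exists_isDecomposition [FiniteDimensional ℝ V] {X : V}
    (hX : X ∈ form.orthogonal (spaceF R Rs R')) :
    ∃ αp αm : R.domain, IsDecomposition R Rs R' X αp αm := by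
  rw [hR.orthogonal_spaceF hD] at hX
  obtain ⟨p, hp, q, hq, rfl⟩ := Submodule.mem_sup.1 hX
  exact hR.exists_isDecomposition_add hp hq

end OperatorHypotheses

theorem OperatorHypotheses.continuousOn_quadK {E : Type*} [NormedAddCommGroup E] [NormedSpace ℝ E]
    [FiniteDimensional ℝ E] {form : LinearMap.BilinForm ℝ E} {G G' : Submodule ℝ E}
    {R Rs R' Rs' : E →ₗ.[ℝ] E} (hR : OperatorHypotheses form G G' R Rs R' Rs')
    (hD : IsLagrangianPair form G G') :
    ContinuousOn (quadK form R Rs R') (form.orthogonal (spaceF R Rs R') : Set E) := by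
  obtain ⟨p, q, hpq⟩ := exists_linearMap_add_eq (spaceR R R') (spaceRPerp Rs R')
  rw [hR.orthogonal_spaceF hD, continuousOn_iff_continuous_domRestrict]
  let β := LinearMap.toContinuousBilinearMap form
  have hp := p.continuous_of_finiteDimensional
  have hq := q.continuous_of_finiteDimensional
  refine Continuous.congr (f := fun x => β (p x) (p x) - β (q x) (q x)) (by fun_prop) fun x => ?_
  obtain ⟨hpx, hqx, hx⟩ := hpq x
  exact (hR.quadK_add hD hpx hqx).symm.trans (congrArg _ hx)

end QuadraticForm

section Intertwining

variable {V : Type*} [AddCommGroup V] [Module ℝ V] {form : LinearMap.BilinForm ℝ V}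
  {G G' : Submodule ℝ V} {R Rs R' Rs' : V →ₗ.[ℝ] V} {A B : V →ₗ[ℝ] V}

namespace OperatorHypotheses

variable (hR : OperatorHypotheses form G G' R Rs R' Rs') (hc : IsCompl G G')

include hR

theorem exists_map_add_apply
    (hA : IntertwiningIdentity (G.projection G' hc) (G'.projection G hc.symm) R A)
    (γ : R.domain) : ∃ δ : R.domain, A (γ + R γ) = δ + R δ := by
  obtain ⟨h₁, h₂, e⟩ := hA γ
  have hsum := Submodule.projection_add_projection_eq_self hc
  rw [Submodule.projection_apply_of_mem_left hc (hR.apply_mem _)] at e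
  refine ⟨⟨G'.projection G hc.symm (A γ), h₁⟩ + ⟨G'.projection G hc.symm (A (R γ)), h₂⟩, ?_⟩
  rw [map_add, R.map_add, ← e, Submodule.coe_add]
  nth_rewrite 1 [← hsum (A γ), ← hsum (A (R γ))]
  abel

theorem map_domain_le
    (hA : IntertwiningIdentity (G.projection G' hc) (G'.projection G hc.symm) R A)
    (hA' : IntertwiningIdentity (G'.projection G hc.symm) (G.projection G' hc) R' A) :
    R.domain.map A ≤ R.domain ⊔ R'.domain := by
  rintro _ ⟨x, hx, rfl⟩
  obtain ⟨k, hk, y, e⟩ := hR.exists_opKer_add_apply ⟨x, hx⟩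
  obtain ⟨δ, hδ⟩ := hR.exists_map_add_apply hc hA k
  have hAk : G.projection G' hc (A k) ∈ R'.domain := by
    rw [hk, add_zero] at hδ
    rw [hδ, map_add, (Submodule.projection_apply_eq_zero_iff hc).2 (hR.dom_le δ.2), zero_add,
      Submodule.projection_apply_of_mem_left hc (hR.apply_mem δ)]
    exact hR.im_le_dom' (apply_mem_opIm R δ)
  have hAx : G.projection G' hc (A x) ∈ R'.domain := by
    rw [show x = k + R' y from e, map_add, map_add]
    exact add_mem hAk (hA' y).2.1
  rw [← Submodule.projection_add_projection_eq_self hc.symm (A x)]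
  exact Submodule.add_mem_sup (hA ⟨x, hx⟩).1 hAx

theorem map_mem_spaceR
    (hA : IntertwiningIdentity (G.projection G' hc) (G'.projection G hc.symm) R A)
    (hker : ∀ k ∈ opKer R', A k ∈ opKer R') {X : V} (hX : X ∈ spaceR R R') : A X ∈ spaceR R R' := by
  obtain ⟨k, hk, γ, rfl⟩ := mem_spaceR.1 hX
  obtain ⟨δ, hδ⟩ := hR.exists_map_add_apply hc hA γ
  rw [map_add, hδ]
  exact mem_spaceR.2 ⟨_, hker k hk, δ, rfl⟩

variable [FiniteDimensional ℝ V] (hD : IsLagrangianPair form G G')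
  (hBA : form.IsAdjointPair form B A)

include hD hBA

theorem map_mem_opKer_sup_opKer
    (hB : IntertwiningIdentity (G.projection G' hc) (G'.projection G hc.symm) R B)
    (hB' : IntertwiningIdentity (G'.projection G hc.symm) (G.projection G' hc) R' B)
    {X : V} (hX : X ∈ opKer R ⊔ opKer R') : A X ∈ opKer R ⊔ opKer R' := by
  have hmap : (R.domain ⊔ R'.domain).map B ≤ R.domain ⊔ R'.domain := by
    rw [Submodule.map_sup]
    exact sup_le (hR.map_domain_le hc hB hB')
      (sup_comm R.domain R'.domain ▸ hR.swap.map_domain_le hc.symm hB' hB)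
  rw [← hD.orthogonal_orthogonal (opKer R ⊔ opKer R'), hR.orthogonal_opKer_sup_opKer hD] at hX ⊢
  exact map_mem_orthogonal hBA (fun Y hY => hmap (Submodule.mem_map_of_mem hY)) hX

theorem map_mem_opKer
    (hA : IntertwiningIdentity (G.projection G' hc) (G'.projection G hc.symm) R A)
    (hB : IntertwiningIdentity (G.projection G' hc) (G'.projection G hc.symm) R B)
    (hB' : IntertwiningIdentity (G'.projection G hc.symm) (G.projection G' hc) R' B)
    {n : V} (hn : n ∈ opKer R) : A n ∈ opKer R := by
  obtain ⟨hn_dom, hRn⟩ := mem_opKer.1 hn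
  obtain ⟨δ, hδ⟩ := hR.exists_map_add_apply hc hA ⟨n, hn_dom⟩
  rw [hRn, add_zero] at hδ
  obtain ⟨k, hk, k', hk', e⟩ := Submodule.mem_sup.1
    (hR.map_mem_opKer_sup_opKer hc hD hBA hB hB' (Submodule.mem_sup_left hn))
  have hδk : (δ : V) = k := by
    have hG' : (δ : V) - k ∈ G' := sub_mem (hR.dom_le δ.2) (hR.opKer_le hk)
    have hG : k' - R δ ∈ G := sub_mem (hR.swap.opKer_le hk') (hR.apply_mem δ)
    have heq : (δ : V) - k = k' - R δ := by
      rw [sub_eq_sub_iff_add_eq_add, ← hδ, ← e, add_comm]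
    exact sub_eq_zero.1 (Submodule.disjoint_def.1 hc.disjoint _ (heq ▸ hG) hG')
  obtain ⟨hk_dom, hRk⟩ := mem_opKer.1 hk
  have hRδ : R δ = 0 := (congrArg R.toFun (Subtype.ext hδk : δ = ⟨k, hk_dom⟩)).trans hRk
  rw [hδ, hRδ, add_zero, hδk]
  exact hk

end OperatorHypotheses

end Intertwining


section LogarithmicDerivative

open Filter Topology

variable {E : Type*} [NormedAddCommGroup E] [NormedSpace ℝ E]
  {D : Type*} [TopologicalSpace D] [ChartedSpace E D] [Group D]
  {S : Type*} [NormedAddCommGroup S] [NormedSpace ℝ S]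

variable (E) in
/-- The logarithmic derivative `du u⁻¹` with the Lie algebra identified with the model space `E`,
which, unlike the tangent space at `1`, is a normed space. -/
def rightDeriv (u : S → D) (x : S) : S →L[ℝ] E := rightLogDeriv E u x

variable (E) in
/-- The adjoint action on the Lie algebra, the latter being identified with the model space. -/
def adjoint (g : D) : E →L[ℝ] E := Ad E g

theorem rightDeriv_congr {u v : S → D} {x : S} (h : u =ᶠ[𝓝 x] v) :
    rightDeriv E u x = rightDeriv E v x := by
  have e : (fun y => u y * (u x)⁻¹) =ᶠ[𝓝 x] fun y => v y * (v x)⁻¹ := by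
    filter_upwards [h] with y hy
    rw [hy, h.self_of_nhds]
  exact e.mfderiv_eq

theorem rightDeriv_const (d : D) (x : S) : rightDeriv E (fun _ : S => d) x = 0 :=
  mfderiv_const

variable [LieGroup 𝓘(ℝ, E) ∞ D]

theorem contMDiff_conj (g : D) : ContMDiff 𝓘(ℝ, E) 𝓘(ℝ, E) ∞ fun y : D => g * y * g⁻¹ :=
  (contMDiff_const.mul contMDiff_id).mul contMDiff_const

theorem hasMFDerivAt_conj (g : D) {y : D} (hy : y = 1) :
    HasMFDerivAt 𝓘(ℝ, E) 𝓘(ℝ, E) (fun y : D => g * y * g⁻¹) y (adjoint E g) := by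
  subst hy
  exact ((contMDiff_conj g).mdifferentiableAt (by simp)).hasMFDerivAt

theorem adjoint_one : adjoint E (1 : D) = .id ℝ E := by
  have e : (fun y : D => 1 * y * 1⁻¹) = id := by
    ext y
    simp
  have h := hasMFDerivAt_conj (E := E) (1 : D) rfl
  rw [e] at h
  exact h.mfderiv.symm.trans mfderiv_id

theorem adjoint_mul (g h : D) : adjoint E (g * h) = adjoint E g ∘L adjoint E h := by
  have e : (fun y : D => g * h * y * (g * h)⁻¹) =
      (fun y => g * y * g⁻¹) ∘ fun y => h * y * h⁻¹ := by
    ext y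
    simp only [Function.comp_apply]
    group
  have hcomp := (hasMFDerivAt_conj (E := E) g (by simp)).comp 1 (hasMFDerivAt_conj h rfl)
  rw [← e] at hcomp
  exact hcomp.mfderiv

theorem adjoint_apply_adjoint_inv (g : D) (X : E) : adjoint E g (adjoint E g⁻¹ X) = X := by
  rw [← ContinuousLinearMap.comp_apply, ← adjoint_mul, mul_inv_cancel, adjoint_one,
    ContinuousLinearMap.id_apply]

theorem mdifferentiableAt_mul_const {u : S → D} {x : S}
    (hu : MDifferentiableAt 𝓘(ℝ, S) 𝓘(ℝ, E) u x) (d : D) :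
    MDifferentiableAt 𝓘(ℝ, S) 𝓘(ℝ, E) (fun y => u y * d) x :=
  ((contMDiff_mul_right (n := ∞)).mdifferentiableAt (by simp)).comp x hu

theorem hasMFDerivAt_mul_inv_self {u : S → D} {x : S}
    (hu : MDifferentiableAt 𝓘(ℝ, S) 𝓘(ℝ, E) u x) :
    HasMFDerivAt 𝓘(ℝ, S) 𝓘(ℝ, E) (fun y => u y * (u x)⁻¹) x
      (rightDeriv E u x : S →L[ℝ] E) :=
  (mdifferentiableAt_mul_const hu _).hasMFDerivAt

theorem rightDeriv_comp {S' : Type*} [NormedAddCommGroup S'] [NormedSpace ℝ S'] {u : S → D}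
    {g : S' → S} {x : S'} (hu : MDifferentiableAt 𝓘(ℝ, S) 𝓘(ℝ, E) u (g x))
    (hg : DifferentiableAt ℝ g x) :
    rightDeriv E (fun y => u (g y)) x = rightDeriv E u (g x) ∘L fderiv ℝ g x :=
  have hg' : HasMFDerivAt 𝓘(ℝ, S') 𝓘(ℝ, S) g x (fderiv ℝ g x : S' →L[ℝ] S) :=
    hasMFDerivAt_iff_hasFDerivAt.2 hg.hasFDerivAt
  ((hasMFDerivAt_mul_inv_self hu).comp x hg').mfderiv

theorem hasMFDerivAt_mul_of_eq_one {p : D × D} (hp : p = 1) :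
    HasMFDerivAt (𝓘(ℝ, E).prod 𝓘(ℝ, E)) 𝓘(ℝ, E) (fun p : D × D => p.1 * p.2) p
      (ContinuousLinearMap.fst ℝ E E + ContinuousLinearMap.snd ℝ E E) := by
  subst hp
  have hmul : MDifferentiableAt (𝓘(ℝ, E).prod 𝓘(ℝ, E)) 𝓘(ℝ, E) (fun p : D × D => p.1 * p.2) 1 :=
    (contMDiff_mul 𝓘(ℝ, E) ∞).mdifferentiableAt (by simp)
  refine hmul.hasMFDerivAt.congr_mfderiv (ContinuousLinearMap.ext fun v => ?_)
  refine (mfderiv_prod_eq_add_apply hmul).trans ?_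
  have hl : (fun z : D => z * (1 : D × D).2) = id := funext fun z => mul_one z
  have hr : (fun z : D => (1 : D × D).1 * z) = id := funext fun z => one_mul z
  rw [hl, hr]
  exact congrArg₂ (· + ·) (DFunLike.congr_fun mfderiv_id v.1) (DFunLike.congr_fun mfderiv_id v.2)

theorem hasMFDerivAt_mul {v w : S → D} {x : S} {v' w' : S →L[ℝ] E}
    (hv : HasMFDerivAt 𝓘(ℝ, S) 𝓘(ℝ, E) v x v') (hw : HasMFDerivAt 𝓘(ℝ, S) 𝓘(ℝ, E) w x w')
    (hvx : v x = 1) (hwx : w x = 1) :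
    HasMFDerivAt 𝓘(ℝ, S) 𝓘(ℝ, E) (fun y => v y * w y) x (v' + w') :=
  (hasMFDerivAt_mul_of_eq_one (Prod.ext hvx hwx)).comp x (hv.prodMk hw)

theorem rightDeriv_mul {u v : S → D} {x : S} (hu : MDifferentiableAt 𝓘(ℝ, S) 𝓘(ℝ, E) u x)
    (hv : MDifferentiableAt 𝓘(ℝ, S) 𝓘(ℝ, E) v x) :
    rightDeriv E (fun y => u y * v y) x =
      rightDeriv E u x + adjoint E (u x) ∘L rightDeriv E v x := by
  have e : (fun y => u y * v y * (u x * v x)⁻¹) = fun y =>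
      (u y * (u x)⁻¹) * (u x * (v y * (v x)⁻¹) * (u x)⁻¹) := by
    ext y
    group
  have hconj : HasMFDerivAt 𝓘(ℝ, S) 𝓘(ℝ, E) (fun y => u x * (v y * (v x)⁻¹) * (u x)⁻¹) x
      (adjoint E (u x) ∘L rightDeriv E v x : S →L[ℝ] E) :=
    (hasMFDerivAt_conj (u x) (mul_inv_cancel (v x))).comp x (hasMFDerivAt_mul_inv_self hv)
  have h := hasMFDerivAt_mul (hasMFDerivAt_mul_inv_self hu) hconj (by simp) (by simp)
  rw [← e] at h
  exact h.mfderiv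

omit [LieGroup 𝓘(ℝ, E) ∞ D] in
theorem rightDeriv_map {E₁ : Type*} [NormedAddCommGroup E₁] [NormedSpace ℝ E₁]
    {F : Type*} [TopologicalSpace F] [ChartedSpace E₁ F] [Group F] [LieGroup 𝓘(ℝ, E₁) ∞ F]
    {ι : F →* D} {u : S → F} {x : S} (hι : MDifferentiableAt 𝓘(ℝ, E₁) 𝓘(ℝ, E) ι 1)
    (hu : MDifferentiableAt 𝓘(ℝ, S) 𝓘(ℝ, E₁) u x) :
    rightDeriv E (fun y => ι (u y)) x =
      (mfderiv 𝓘(ℝ, E₁) 𝓘(ℝ, E) ι 1 : E₁ →L[ℝ] E) ∘L rightDeriv E₁ u x := by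
  have e : (fun y => ι (u y) * (ι (u x))⁻¹) = ι ∘ fun y => u y * (u x)⁻¹ := by
    ext y
    simp
  have h := mfderiv_comp_of_eq hι (hasMFDerivAt_mul_inv_self hu).mdifferentiableAt (by simp)
  rw [← e, mul_inv_cancel] at h
  exact h

end LogarithmicDerivative

section MaurerCartan

open Filter Topology

variable {E : Type*} [NormedAddCommGroup E] [NormedSpace ℝ E]
  {D : Type*} [TopologicalSpace D] [ChartedSpace E D] [Group D]
  {S : Type*} [NormedAddCommGroup S] [NormedSpace ℝ S]

variable (E) in
/-- The coordinates in the preferred chart at the identity. -/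
def toCoord (d : D) : E := extChartAt 𝓘(ℝ, E) (1 : D) d

variable (D) in
/-- The inverse of the preferred chart at the identity. -/
def ofCoord (y : E) : D := (extChartAt 𝓘(ℝ, E) (1 : D)).symm y

variable (E D) in
/-- The multiplication of the group in the preferred chart at the identity. -/
def coordMul (p : E × E) : E := toCoord E (ofCoord D p.1 * ofCoord D p.2)

variable (E D) in
/-- The Lie bracket transported to the model space. -/
def modelBracket (X Y : E) : E :=
  @Bracket.bracket (GroupLieAlgebra 𝓘(ℝ, E) D) (GroupLieAlgebra 𝓘(ℝ, E) D) _ X Y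

theorem ofCoord_toCoord_one : ofCoord D (toCoord E (1 : D)) = 1 := extChartAt_to_inv (1 : D)

theorem eventually_ofCoord_toCoord : ∀ᶠ d : D in 𝓝 1, ofCoord D (toCoord E d) = d := by
  filter_upwards [extChartAt_source_mem_nhds (I := 𝓘(ℝ, E)) (1 : D)] with d hd
  exact (extChartAt 𝓘(ℝ, E) (1 : D)).left_inv hd

theorem eventually_ofCoord_toCoord_comp {X : Type*} [TopologicalSpace X] {v : X → D} {x : X}
    (hv : ContinuousAt v x) (hvx : v x = 1) : ∀ᶠ y in 𝓝 x, ofCoord D (toCoord E (v y)) = v y := by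
  refine hv.tendsto.eventually (p := fun d => ofCoord D (toCoord E d) = d) ?_
  rw [hvx]
  exact eventually_ofCoord_toCoord

theorem eventually_toCoord_ofCoord :
    ∀ᶠ y : E in 𝓝 (toCoord E (1 : D)), toCoord E (ofCoord D y) = y := by
  filter_upwards [extChartAt_target_mem_nhds (1 : D)] with y hy
  exact (extChartAt 𝓘(ℝ, E) (1 : D)).right_inv hy

theorem contMDiffAt_ofCoord [IsManifold 𝓘(ℝ, E) ∞ D] {y : E}
    (hy : y ∈ (extChartAt 𝓘(ℝ, E) (1 : D)).target) :
    ContMDiffAt 𝓘(ℝ, E) 𝓘(ℝ, E) ∞ (ofCoord D) y :=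
  (contMDiffOn_extChartAt_symm (1 : D)).contMDiffAt (extChartAt_target_mem_nhds' hy)

theorem contDiffAt_toCoord_comp [IsManifold 𝓘(ℝ, E) ∞ D] {v : S → D} {x : S}
    (hv : ContMDiffAt 𝓘(ℝ, S) 𝓘(ℝ, E) ∞ v x) (hvx : v x = 1) :
    ContDiffAt ℝ ∞ (fun y => toCoord E (v y)) x := by
  have h : ContMDiffAt 𝓘(ℝ, E) 𝓘(ℝ, E) ∞ (toCoord E : D → E) (v x) := by
    rw [hvx]
    exact contMDiffAt_extChartAt
  exact (h.comp x hv).contDiffAt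

theorem hasMFDerivAt_toCoord [IsManifold 𝓘(ℝ, E) ∞ D] {d : D} (hd : d = 1) :
    HasMFDerivAt 𝓘(ℝ, E) 𝓘(ℝ, E) (toCoord E) d (.id ℝ E : E →L[ℝ] E) := by
  subst hd
  have h := (mdifferentiableAt_extChartAt (I := 𝓘(ℝ, E)) (mem_chart_source E (1 : D))).hasMFDerivAt
  rwa [mfderiv_extChartAt_self] at h

theorem hasFDerivAt_toCoord_comp [IsManifold 𝓘(ℝ, E) ∞ D] {v : S → D} {x : S} {v' : S →L[ℝ] E}
    (hv : HasMFDerivAt 𝓘(ℝ, S) 𝓘(ℝ, E) v x v') (hvx : v x = 1) :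
    HasFDerivAt (fun y => toCoord E (v y)) v' x :=
  hasMFDerivAt_iff_hasFDerivAt.1 ((hasMFDerivAt_toCoord hvx).comp x hv)

variable [LieGroup 𝓘(ℝ, E) ∞ D]

instance isManifold_of_lieGroup : IsManifold 𝓘(ℝ, E) ∞ D := LieGroup.toContMDiffMul.toIsManifold

theorem contDiffAt_coordMul :
    ContDiffAt ℝ ∞ (coordMul E D) (toCoord E (1 : D), toCoord E (1 : D)) := by
  have hc : ContMDiffAt 𝓘(ℝ, E) 𝓘(ℝ, E) ∞ (ofCoord D) (toCoord E (1 : D)) :=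
    contMDiffAt_ofCoord (mem_extChartAt_target 1)
  refine contDiffAt_toCoord_comp (ContMDiffAt.mul ?_ ?_) (by simp [ofCoord_toCoord_one])
  · exact ContMDiffAt.comp (_, _) hc contDiffAt_fst.contMDiffAt
  · exact ContMDiffAt.comp (_, _) hc contDiffAt_snd.contMDiffAt

theorem eventually_differentiableAt_coordMul :
    ∀ᶠ p in 𝓝 (toCoord E (1 : D), toCoord E (1 : D)), DifferentiableAt ℝ (coordMul E D) p := by
  filter_upwards [(contDiffAt_coordMul.of_le (m := 1) (by simp)).eventually (by simp)] with p hp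
  exact hp.differentiableAt (by simp)

theorem hasFDerivAt_fderiv_coordMul :
    HasFDerivAt (fderiv ℝ (coordMul E D))
      (fderiv ℝ (fderiv ℝ (coordMul E D)) (toCoord E (1 : D), toCoord E (1 : D)))
      (toCoord E (1 : D), toCoord E (1 : D)) :=
  ((contDiffAt_coordMul.fderiv_right (m := ∞) (by simp)).differentiableAt (by simp)).hasFDerivAt

theorem fderiv_coordMul_zero_right (X : E) :
    fderiv ℝ (coordMul E D) (toCoord E (1 : D), toCoord E (1 : D)) (0, X) = X := by
  have h := HasFDerivAt.comp (toCoord E (1 : D))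
    (contDiffAt_coordMul (D := D).differentiableAt (by simp)).hasFDerivAt
    (hasFDerivAt_prodMk_right (toCoord E (1 : D)) _)
  refine DFunLike.congr_fun (h.unique ((hasFDerivAt_id _).congr_of_eventuallyEq ?_)) X
  filter_upwards [eventually_toCoord_ofCoord (D := D)] with y hy
  simp [coordMul, ofCoord_toCoord_one, hy]

theorem hasMFDerivAt_ofCoord_mul {y : E} (hy : y ∈ (extChartAt 𝓘(ℝ, E) (1 : D)).target)
    (hM : DifferentiableAt ℝ (coordMul E D) (y, toCoord E (1 : D))) :
    HasMFDerivAt 𝓘(ℝ, E) 𝓘(ℝ, E) (fun g => ofCoord D y * g) 1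
      ((mfderiv 𝓘(ℝ, E) 𝓘(ℝ, E) (ofCoord D) y : E →L[ℝ] E) ∘L
        (fderiv ℝ (coordMul E D) (y, toCoord E (1 : D)) ∘L .inr ℝ E E)) := by
  have hφ : HasMFDerivAt 𝓘(ℝ, E) 𝓘(ℝ, E) (fun g => coordMul E D (y, toCoord E g)) (1 : D)
      (fderiv ℝ (coordMul E D) (y, toCoord E (1 : D)) ∘L .inr ℝ E E : E →L[ℝ] E) :=
    (hasMFDerivAt_iff_hasFDerivAt.2
      (hM.hasFDerivAt.comp _ (hasFDerivAt_prodMk_right y _))).comp 1 (hasMFDerivAt_toCoord rfl)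
  have hφ1 : coordMul E D (y, toCoord E (1 : D)) = y := by
    rw [coordMul, ofCoord_toCoord_one, mul_one]
    exact (extChartAt 𝓘(ℝ, E) (1 : D)).right_inv hy
  have hsymm : HasMFDerivAt 𝓘(ℝ, E) 𝓘(ℝ, E) (ofCoord D) (coordMul E D (y, toCoord E (1 : D)))
      (mfderiv 𝓘(ℝ, E) 𝓘(ℝ, E) (ofCoord D) y : E →L[ℝ] E) := by
    rw [hφ1]
    exact ((contMDiffAt_ofCoord hy).mdifferentiableAt (by simp)).hasMFDerivAt
  refine (hsymm.comp 1 hφ).congr_of_eventuallyEq ?_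
  have hs : (extChartAt 𝓘(ℝ, E) (1 : D)).source ∈ 𝓝 (ofCoord D y * 1) := by
    rw [mul_one]
    exact extChartAt_source_mem_nhds' ((extChartAt 𝓘(ℝ, E) (1 : D)).map_target hy)
  filter_upwards [(contMDiff_mul_left (I := 𝓘(ℝ, E)) (n := ∞)).continuous.continuousAt hs,
    eventually_ofCoord_toCoord (E := E) (D := D)] with g hg hg'
  simp only [Function.comp_apply, coordMul, hg']
  exact ((extChartAt 𝓘(ℝ, E) (1 : D)).left_inv hg).symm

theorem eventually_mpullback_mulInvariantVectorField (X : E) :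
    ∀ᶠ y in 𝓝 (toCoord E (1 : D)),
      (VectorField.mpullbackWithin 𝓘(ℝ, E) 𝓘(ℝ, E) (extChartAt 𝓘(ℝ, E) (1 : D)).symm
        (mulInvariantVectorField (X : GroupLieAlgebra 𝓘(ℝ, E) D)) (Set.range 𝓘(ℝ, E)) y : E) =
      fderiv ℝ (coordMul E D) (y, toCoord E (1 : D)) (0, X) := by
  have hM : ∀ᶠ y in 𝓝 (toCoord E (1 : D)),
      DifferentiableAt ℝ (coordMul E D) (y, toCoord E (1 : D)) :=
    (Continuous.prodMk_left (toCoord E (1 : D))).continuousAt.eventually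
      eventually_differentiableAt_coordMul
  filter_upwards [extChartAt_target_mem_nhds (I := 𝓘(ℝ, E)) (1 : D), hM] with y hy hMy
  have hinv := isInvertible_mfderivWithin_extChartAt_symm (I := 𝓘(ℝ, E)) hy
  refine hinv.inverse_apply_eq.2 ?_
  rw [modelWithCornersSelf_coe, Set.range_id, mfderivWithin_univ]
  exact DFunLike.congr_fun (hasMFDerivAt_ofCoord_mul hy hMy).mfderiv X

theorem hasFDerivAt_fderiv_coordMul_left (X : E) :
    HasFDerivAt (fun y : E => fderiv ℝ (coordMul E D) (y, toCoord E (1 : D)) (0, X))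
      (ContinuousLinearMap.apply ℝ E (0, X) ∘L fderiv ℝ (fderiv ℝ (coordMul E D))
        (toCoord E (1 : D), toCoord E (1 : D)) ∘L .inl ℝ E E) (toCoord E (1 : D)) :=
  (ContinuousLinearMap.apply ℝ E ((0, X) : E × E)).hasFDerivAt.comp (toCoord E (1 : D))
    (hasFDerivAt_fderiv_coordMul.comp (toCoord E (1 : D)) (hasFDerivAt_prodMk_left _ _))

theorem modelBracket_eq (X Y : E) :
    modelBracket E D X Y =
      fderiv ℝ (fderiv ℝ (coordMul E D)) (toCoord E (1 : D), toCoord E (1 : D)) (X, 0) (0, Y) -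
      fderiv ℝ (fderiv ℝ (coordMul E D)) (toCoord E (1 : D), toCoord E (1 : D)) (Y, 0) (0, X) := by
  let A : E →L[ℝ] E := mfderiv 𝓘(ℝ, E) 𝓘(ℝ, E) (extChartAt 𝓘(ℝ, E) (1 : D)) (1 : D)
  let field (X : E) (y : E) : E := VectorField.mpullbackWithin 𝓘(ℝ, E) 𝓘(ℝ, E)
    (extChartAt 𝓘(ℝ, E) (1 : D)).symm (mulInvariantVectorField (X : GroupLieAlgebra 𝓘(ℝ, E) D))
    (Set.range 𝓘(ℝ, E)) y
  have h : modelBracket E D X Y = A.inverse (VectorField.lieBracketWithin ℝ (field X) (field Y)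
      ((extChartAt 𝓘(ℝ, E) (1 : D)).symm ⁻¹' Set.univ ∩ Set.range 𝓘(ℝ, E))
      (toCoord E (1 : D))) := rfl
  have hA : A = .id ℝ E := mfderiv_extChartAt_self
  have huniv : ((extChartAt 𝓘(ℝ, E) (1 : D)).symm ⁻¹' Set.univ ∩ Set.range 𝓘(ℝ, E)) = Set.univ := by
    simp
  rw [hA, ContinuousLinearMap.inverse_id, huniv, VectorField.lieBracketWithin_univ] at h
  refine h.trans ((EventuallyEq.lieBracket_vectorField_eq (𝕜 := ℝ)
    (eventually_mpullback_mulInvariantVectorField X)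
    (eventually_mpullback_mulInvariantVectorField Y)).trans ?_)
  rw [VectorField.lieBracket, (hasFDerivAt_fderiv_coordMul_left X).fderiv,
    (hasFDerivAt_fderiv_coordMul_left Y).fderiv]
  simp [fderiv_coordMul_zero_right]

theorem rightDeriv_eq_fderiv {u : S → D} {x : S} (hu : MDifferentiableAt 𝓘(ℝ, S) 𝓘(ℝ, E) u x) :
    rightDeriv E u x = fderiv ℝ (fun y => toCoord E (u y * (u x)⁻¹)) x :=
  (hasFDerivAt_toCoord_comp (hasMFDerivAt_mul_inv_self hu) (mul_inv_cancel _)).fderiv.symm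

theorem rightDeriv_eq_fderiv_coordMul_comp {u : S → D} {x : S} {d : D}
    (hu : MDifferentiableAt 𝓘(ℝ, S) 𝓘(ℝ, E) u x)
    (hud : ∀ᶠ y in 𝓝 x, ofCoord D (toCoord E (u y * d⁻¹)) = u y * d⁻¹)
    (hdu : ofCoord D (toCoord E (d * (u x)⁻¹)) = d * (u x)⁻¹)
    (hV : DifferentiableAt ℝ (fun y => toCoord E (u y * d⁻¹)) x)
    (hM : DifferentiableAt ℝ (coordMul E D)
      (toCoord E (u x * d⁻¹), toCoord E (d * (u x)⁻¹))) :
    rightDeriv E u x =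
      fderiv ℝ (coordMul E D) (toCoord E (u x * d⁻¹), toCoord E (d * (u x)⁻¹)) ∘L
        (.inl ℝ E E ∘L fderiv ℝ (fun y => toCoord E (u y * d⁻¹)) x) := by
  have e : (fun y => toCoord E (u y * (u x)⁻¹)) =ᶠ[𝓝 x] coordMul E D ∘
      fun y => (toCoord E (u y * d⁻¹), toCoord E (d * (u x)⁻¹)) := by
    filter_upwards [hud] with y hy
    simp only [Function.comp_apply, coordMul, hy, hdu]
    congr 1
    group
  rw [rightDeriv_eq_fderiv hu, e.fderiv_eq]
  exact (hM.hasFDerivAt.comp x (hV.hasFDerivAt.prodMk (hasFDerivAt_const _ _))).fderiv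

section Smooth

variable {u : S → D} {x : S} (hu : ContMDiffAt 𝓘(ℝ, S) 𝓘(ℝ, E) ∞ u x)

include hu

theorem contDiffAt_toCoord_mul_inv : ContDiffAt ℝ ∞ (fun y => toCoord E (u y * (u x)⁻¹)) x :=
  contDiffAt_toCoord_comp (hu.mul contMDiffAt_const) (mul_inv_cancel _)

theorem contDiffAt_toCoord_const_mul_inv :
    ContDiffAt ℝ ∞ (fun y => toCoord E (u x * (u y)⁻¹)) x :=
  contDiffAt_toCoord_comp (contMDiffAt_const.mul hu.inv) (mul_inv_cancel _)

theorem eventually_rightDeriv_eq :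
    ∀ᶠ z in 𝓝 x, rightDeriv E u z =
      fderiv ℝ (coordMul E D) (toCoord E (u z * (u x)⁻¹), toCoord E (u x * (u z)⁻¹)) ∘L
        (.inl ℝ E E ∘L fderiv ℝ (fun y => toCoord E (u y * (u x)⁻¹)) z) := by
  have hV := contDiffAt_toCoord_mul_inv hu
  have hW := contDiffAt_toCoord_const_mul_inv hu
  have hu1 : ∀ᶠ z in 𝓝 x, ContMDiffAt 𝓘(ℝ, S) 𝓘(ℝ, E) 1 u z :=
    (contMDiffAt_iff_contMDiffAt_nhds (by simp)).1 (hu.of_le (by simp))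
  have hV1 := (hV.of_le (m := 1) (by simp)).eventually (by simp)
  have hM := (hV.continuousAt.prodMk hW.continuousAt).eventually
    (p := fun p => DifferentiableAt ℝ (coordMul E D) p)
    (by simpa using eventually_differentiableAt_coordMul)
  have hud := eventually_ofCoord_toCoord_comp (E := E)
    (hu.mul contMDiffAt_const).continuousAt (mul_inv_cancel (u x))
  have hdu := eventually_ofCoord_toCoord_comp (E := E)
    (contMDiffAt_const.mul hu.inv).continuousAt (mul_inv_cancel (u x))
  filter_upwards [hu1, hV1, hM, hud.eventually_nhds, hdu] with z huz hVz hMz hudz hduz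
  exact rightDeriv_eq_fderiv_coordMul_comp (huz.mdifferentiableAt (by simp)) hudz hduz
    (hVz.differentiableAt (by simp)) hMz

theorem contDiffAt_rightDeriv : ContDiffAt ℝ ∞ (rightDeriv E u) x := by
  have hV := contDiffAt_toCoord_mul_inv hu
  have hM : ContDiffAt ℝ ∞ (fderiv ℝ (coordMul E D))
      (toCoord E (u x * (u x)⁻¹), toCoord E (u x * (u x)⁻¹)) := by
    rw [mul_inv_cancel]
    exact contDiffAt_coordMul.fderiv_right (by simp)
  exact ((hM.comp x (hV.prodMk (contDiffAt_toCoord_const_mul_inv hu))).clm_comp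
    (contDiffAt_const.clm_comp (hV.fderiv_right (by simp)))).congr_of_eventuallyEq
    (eventually_rightDeriv_eq hu)

theorem continuousAt_rightDeriv_apply (v : S) : ContinuousAt (fun y => rightDeriv E u y v) x :=
  (contDiffAt_rightDeriv hu).continuousAt.clm_apply continuousAt_const

theorem hasFDerivAt_toCoord_mul_inv :
    HasFDerivAt (fun y => toCoord E (u y * (u x)⁻¹)) (rightDeriv E u x) x := by
  rw [rightDeriv_eq_fderiv (hu.mdifferentiableAt (by simp))]
  exact ((contDiffAt_toCoord_mul_inv hu).differentiableAt (by simp)).hasFDerivAt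

theorem hasFDerivAt_toCoord_const_mul_inv :
    HasFDerivAt (fun y => toCoord E (u x * (u y)⁻¹)) (-rightDeriv E u x) x := by
  have hW : MDifferentiableAt 𝓘(ℝ, S) 𝓘(ℝ, E) (fun y => u x * (u y)⁻¹) x :=
    (contMDiffAt_const.mul hu.inv).mdifferentiableAt (by simp)
  have hVW := hasMFDerivAt_mul (hasMFDerivAt_mul_inv_self (hu.mdifferentiableAt (by simp)))
    hW.hasMFDerivAt (mul_inv_cancel _) (mul_inv_cancel _)
  have e : (fun y => u y * (u x)⁻¹ * (u x * (u y)⁻¹)) = fun _ => 1 := by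
    ext y
    group
  rw [e] at hVW
  have hneg : (mfderiv 𝓘(ℝ, S) 𝓘(ℝ, E) (fun y => u x * (u y)⁻¹) x : S →L[ℝ] E) =
      -rightDeriv E u x :=
    eq_neg_of_add_eq_zero_right (hasMFDerivAt_unique hVW (hasMFDerivAt_const 1 x))
  exact hneg ▸ hasFDerivAt_toCoord_comp hW.hasMFDerivAt (mul_inv_cancel _)

theorem fderiv_rightDeriv_apply (v w : S) :
    fderiv ℝ (rightDeriv E u) x v w =
      fderiv ℝ (coordMul E D) (toCoord E (1 : D), toCoord E (1 : D))
        (fderiv ℝ (fderiv ℝ fun y => toCoord E (u y * (u x)⁻¹)) x v w, 0) +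
      fderiv ℝ (fderiv ℝ (coordMul E D)) (toCoord E (1 : D), toCoord E (1 : D))
        (rightDeriv E u x v, -rightDeriv E u x v) (rightDeriv E u x w, 0) := by
  have hV := hasFDerivAt_toCoord_mul_inv hu
  have hM := hasFDerivAt_fderiv_coordMul (E := E) (D := D)
  rw [← mul_inv_cancel (u x)] at hM
  have hV' := (((contDiffAt_toCoord_mul_inv hu).fderiv_right (m := ∞) (by simp)).differentiableAt
    (by simp)).hasFDerivAt
  have h := (hM.comp x (hV.prodMk (hasFDerivAt_toCoord_const_mul_inv hu))).clm_comp
    ((hasFDerivAt_const (ContinuousLinearMap.inl ℝ E E) x).clm_comp hV')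
  rw [(h.congr_of_eventuallyEq (eventually_rightDeriv_eq hu)).fderiv]
  simp [hV.fderiv]

theorem maurerCartan (v w : S) :
    fderiv ℝ (rightDeriv E u) x v w - fderiv ℝ (rightDeriv E u) x w v =
      modelBracket E D (rightDeriv E u x v) (rightDeriv E u x w) := by
  have htwo : minSmoothness ℝ 2 ≤ (∞ : WithTop ℕ∞) := by
    simpa using (ENat.LEInfty.out : (2 : WithTop ℕ∞) ≤ ∞)
  have hM := (contDiffAt_coordMul (E := E) (D := D)).isSymmSndFDerivAt htwo
  have hV := (contDiffAt_toCoord_mul_inv hu).isSymmSndFDerivAt htwo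
  have hneg (X : E) : ((X, -X) : E × E) = (X, 0) - (0, X) := by simp
  simp only [modelBracket_eq, fderiv_rightDeriv_apply hu, hV.eq w v, hneg, map_sub, sub_apply,
    hM.eq (0, _) (_, 0), hM.eq (rightDeriv E u x w, 0) (rightDeriv E u x v, 0)]
  abel

end Smooth

end MaurerCartan

section Integration

open Filter Topology

variable {X Y : Type*} [NormedAddCommGroup X] [NormedSpace ℝ X] [NormedAddCommGroup Y]
  [NormedSpace ℝ Y] {U W : Set X}

theorem contDiff_indicator {n : WithTop ℕ∞} {a : X → Y} (hU : IsOpen U) (hW : IsClosed W)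
    (hWU : W ⊆ U) (ha : ∀ x ∈ U, ContDiffAt ℝ n a x) (ha₀ : ∀ x ∈ U \ W, a x = 0) :
    ContDiff ℝ n (U.indicator a) := by
  refine contDiff_iff_contDiffAt.2 fun x => ?_
  by_cases hx : x ∈ W
  · refine (ha x (hWU hx)).congr_of_eventuallyEq ?_
    filter_upwards [hU.mem_nhds (hWU hx)] with y hy using Set.indicator_of_mem hy a
  · refine (contDiffAt_const (c := (0 : Y))).congr_of_eventuallyEq ?_
    filter_upwards [hW.isOpen_compl.mem_nhds hx] with y hy
    exact Set.indicator_apply_eq_zero.2 fun hyU => ha₀ y ⟨hyU, hy⟩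

theorem continuousOn_fderiv_apply {a : X → Y} (ha : ∀ x ∈ U, ContDiffAt ℝ 1 a x) (v : X) :
    ContinuousOn (fun x => fderiv ℝ a x v) U := fun x hx =>
  (((ha x hx).fderiv_right (m := 0) (by simp)).continuousAt.clm_apply
    continuousAt_const).continuousWithinAt

variable [MeasurableSpace X] [BorelSpace X] {μ : Measure X}

theorem integral_fderiv_eq_zero [FiniteDimensional ℝ X] [μ.IsAddHaarMeasure] {c : X → Y}
    (hc : ContDiff ℝ 1 c) (hcs : HasCompactSupport c) (v : X) : ∫ x, fderiv ℝ c x v ∂μ = 0 := by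
  have hint : Integrable (fun x => fderiv ℝ c x v) μ :=
    ((hc.continuous_fderiv (by simp)).clm_apply continuous_const).integrable_of_hasCompactSupport
      ((hcs.fderiv (𝕜 := ℝ)).comp_left (g := fun L : X →L[ℝ] Y => L v) (by simp))
  simpa using integral_smul_fderiv_eq_neg_fderiv_smul_of_integrable (μ := μ) (v := v)
    (f := fun _ => (1 : ℝ)) (g := c) (by simp) (by simpa using hint)
    (by simpa using hc.continuous.integrable_of_hasCompactSupport hcs)
    (fun _ _ => differentiableAt_const _) fun x _ => hc.differentiable (by simp) x

theorem setIntegral_fderiv_eq_zero [FiniteDimensional ℝ X] [μ.IsAddHaarMeasure] (hU : IsOpen U)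
    (hW : IsCompact W) (hWU : W ⊆ U) {a : X → Y} (ha : ∀ x ∈ U, ContDiffAt ℝ 1 a x)
    (ha₀ : ∀ x ∈ U \ W, a x = 0) (v : X) : ∫ x in W, fderiv ℝ a x v ∂μ = 0 := by
  have hc₀ : ∀ x ∉ W, U.indicator a x = 0 := fun x hx =>
    Set.indicator_apply_eq_zero.2 fun hxU => ha₀ x ⟨hxU, hx⟩
  have hfd : ∀ x ∈ W, fderiv ℝ a x v = fderiv ℝ (U.indicator a) x v := fun x hx => by
    have e : U.indicator a =ᶠ[𝓝 x] a := by
      filter_upwards [hU.mem_nhds (hWU hx)] with y hy using Set.indicator_of_mem hy a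
    rw [e.fderiv_eq]
  rw [setIntegral_congr_fun hW.measurableSet hfd,
    setIntegral_eq_integral_of_forall_compl_eq_zero fun x hx => ?_]
  · exact integral_fderiv_eq_zero (contDiff_indicator hU hW.isClosed hWU ha ha₀)
      (HasCompactSupport.intro hW hc₀) v
  · have e : U.indicator a =ᶠ[𝓝 x] fun _ => 0 := by
      filter_upwards [hW.isClosed.isOpen_compl.mem_nhds hx] with y hy using hc₀ y hy
    rw [e.fderiv_eq, fderiv_const_apply, zero_apply]

theorem setIntegral_fderiv_inr_eq_zero [FiniteDimensional ℝ X] [μ.IsAddHaarMeasure]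
    (hU : IsOpen U) (hW : IsCompact W) (hWU : W ⊆ U) {S : Type*} [NormedAddCommGroup S]
    [NormedSpace ℝ S] {a : S × X → Y} {s : S} (ha : ∀ x ∈ U, ContDiffAt ℝ 1 a (s, x))
    (ha₀ : ∀ x ∈ U \ W, a (s, x) = 0) (v : X) :
    ∫ x in W, fderiv ℝ a (s, x) (0, v) ∂μ = 0 := by
  have hfd : ∀ x ∈ W, fderiv ℝ a (s, x) (0, v) = fderiv ℝ (fun y => a (s, y)) x v := fun x hx => by
    have hs := HasFDerivAt.comp (f := fun y => (s, y)) x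
      ((ha x (hWU hx)).differentiableAt (by simp)).hasFDerivAt (hasFDerivAt_prodMk_right s x)
    exact DFunLike.congr_fun hs.fderiv.symm v
  rw [setIntegral_congr_fun hW.measurableSet hfd]
  exact setIntegral_fderiv_eq_zero hU hW hWU
    (fun x hx => (ha x hx).comp x (contDiffAt_const.prodMk contDiffAt_id)) ha₀ v

theorem setIntegral_sub_eq_intervalIntegral_fderiv [CompleteSpace Y]
    [IsFiniteMeasureOnCompacts μ] [SFinite μ] (hW : IsCompact W) {L : ℝ × X → Y}
    (hL : ∀ z ∈ Set.univ ×ˢ U, ContDiffAt ℝ 1 L z) (hWU : W ⊆ U) (r t : ℝ) :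
    ∫ x in W, L (t, x) ∂μ - ∫ x in W, L (r, x) ∂μ =
      ∫ s in r..t, ∫ x in W, fderiv ℝ L (s, x) (1, 0) ∂μ := by
  have hdL := continuousOn_fderiv_apply hL (1, 0)
  have hslice : ∀ s, IntegrableOn (fun x => L (s, x)) W μ := fun s =>
    ContinuousOn.integrableOn_compact hW fun x hx =>
      ((hL (s, x) ⟨trivial, hWU hx⟩).continuousAt.comp (f := fun y => (s, y))
        (by fun_prop)).continuousWithinAt
  have hFTC : ∀ x ∈ W, L (t, x) - L (r, x) = ∫ s in r..t, fderiv ℝ L (s, x) (1, 0) := by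
    intro x hx
    rw [intervalIntegral.integral_eq_sub_of_hasDerivAt (f := fun s => L (s, x)) (fun s _ => ?_)]
    · exact (hdL.comp (f := fun s : ℝ => (s, x)) (by fun_prop)
        fun s _ => ⟨trivial, hWU hx⟩).intervalIntegrable
    · exact (HasFDerivAt.comp (f := fun s : ℝ => (s, x)) s
        ((hL (s, x) ⟨trivial, hWU hx⟩).differentiableAt (by simp)).hasFDerivAt
        (hasFDerivAt_prodMk_left s x)).hasDerivAt
  have hprod : IntegrableOn (fun z : ℝ × X => fderiv ℝ L z (1, 0)) (Set.uIcc r t ×ˢ W)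
      (volume.prod μ) :=
    (hdL.mono (Set.prod_mono (Set.subset_univ _) hWU)).integrableOn_compact (isCompact_uIcc.prod hW)
  rw [← integral_sub (hslice t) (hslice r), setIntegral_congr_fun hW.measurableSet hFTC,
    intervalIntegral_integral_swap]
  rw [Measure.prod_restrict]
  exact hprod.mono_set (Set.prod_mono Set.uIoc_subset_uIcc subset_rfl)

theorem setIntegral_eq_of_fderiv_eq_divergence [CompleteSpace Y] [FiniteDimensional ℝ X]
    [μ.IsAddHaarMeasure] (hU : IsOpen U) (hW : IsCompact W) (hWU : W ⊆ U) {L a b : ℝ × X → Y}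
    (hL : ∀ z ∈ Set.univ ×ˢ U, ContDiffAt ℝ 1 L z) (ha : ∀ z ∈ Set.univ ×ˢ U, ContDiffAt ℝ 1 a z)
    (hb : ∀ z ∈ Set.univ ×ˢ U, ContDiffAt ℝ 1 b z)
    (ha₀ : ∀ z : ℝ × X, z.2 ∈ U \ W → a z = 0) (hb₀ : ∀ z : ℝ × X, z.2 ∈ U \ W → b z = 0)
    {v w : X} (h : ∀ z ∈ Set.univ ×ˢ U,
      fderiv ℝ L z (1, 0) = fderiv ℝ a z (0, v) + fderiv ℝ b z (0, w)) (r t : ℝ) :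
    ∫ x in W, L (t, x) ∂μ = ∫ x in W, L (r, x) ∂μ := by
  have hint : ∀ {c : ℝ × X → Y}, (∀ z ∈ Set.univ ×ˢ U, ContDiffAt ℝ 1 c z) → ∀ s v,
      IntegrableOn (fun x => fderiv ℝ c (s, x) v) W μ := fun hc s v =>
    ((continuousOn_fderiv_apply hc v).comp (f := fun x => (s, x)) (by fun_prop)
      fun x hx => ⟨trivial, hWU hx⟩).integrableOn_compact hW
  have hzero : ∀ s, ∫ x in W, fderiv ℝ L (s, x) (1, 0) ∂μ = 0 := by
    intro s
    rw [setIntegral_congr_fun hW.measurableSet fun x hx => h (s, x) ⟨trivial, hWU hx⟩,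
      integral_add (hint ha s _) (hint hb s _),
      setIntegral_fderiv_inr_eq_zero hU hW hWU (fun x hx => ha (s, x) ⟨trivial, hx⟩)
        (fun x hx => ha₀ (s, x) hx),
      setIntegral_fderiv_inr_eq_zero hU hW hWU (fun x hx => hb (s, x) ⟨trivial, hx⟩)
        (fun x hx => hb₀ (s, x) hx), add_zero]
  rw [← sub_eq_zero, setIntegral_sub_eq_intervalIntegral_fderiv hW hL hWU]
  simp [hzero]

end Integration

section WessZumino

open Filter Topology

variable {E S X : Type*} [NormedAddCommGroup E] [NormedSpace ℝ E] [NormedAddCommGroup S]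
  [NormedSpace ℝ S] [NormedAddCommGroup X] [NormedSpace ℝ X]

theorem contDiffAt_alternatingMap_apply {κ Y : Type*} [Fintype κ] [NormedAddCommGroup Y]
    [NormedSpace ℝ Y] {n : WithTop ℕ∞} {g : S → E [⋀^κ]→L[ℝ] Y} {m : S → κ → E} {z : S}
    (hg : ContDiffAt ℝ n g z) (hm : ContDiffAt ℝ n m z) :
    ContDiffAt ℝ n (fun y => g y (m y)) z := by
  let c : E [⋀^κ]→L[ℝ] Y →L[ℝ] ContinuousMultilinearMap ℝ (fun _ : κ => E) Y :=
    ContinuousAlternatingMap.toContinuousMultilinearMapCLM ℝ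
  exact ContDiffAt.comp z (c.cpolynomialAt_uncurry_of_multilinear (x := (g z, m z))).contDiffAt
    (hg.prodMk hm)

theorem fderiv_clm_apply_const {A : S → S →L[ℝ] E} {z : S} (hA : DifferentiableAt ℝ A z)
    (v w : S) : fderiv ℝ (fun y => A y v) z w = fderiv ℝ A z w v := by
  simp [fderiv_clm_apply hA (differentiableAt_const v)]

theorem extDeriv_apply_three {Y : Type*} [NormedAddCommGroup Y] [NormedSpace ℝ Y]
    {η : S → S [⋀^Fin 2]→L[ℝ] Y} {z : S} (hη : DifferentiableAt ℝ η z) (v₀ v₁ v₂ : S) :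
    extDeriv η z ![v₀, v₁, v₂] = fderiv ℝ (fun y => η y ![v₁, v₂]) z v₀ -
      fderiv ℝ (fun y => η y ![v₀, v₂]) z v₁ + fderiv ℝ (fun y => η y ![v₀, v₁]) z v₂ := by
  have e₀ : (0 : Fin 3).removeNth ![v₀, v₁, v₂] = ![v₁, v₂] := by
    ext i : 1; fin_cases i <;> rfl
  have e₁ : (1 : Fin 3).removeNth ![v₀, v₁, v₂] = ![v₀, v₂] := by
    ext i : 1; fin_cases i <;> rfl
  have e₂ : (2 : Fin 3).removeNth ![v₀, v₁, v₂] = ![v₀, v₁] := by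
    ext i : 1; fin_cases i <;> rfl
  simp [extDeriv_apply hη, Fin.sum_univ_three, e₀, e₁, e₂, sub_eq_add_neg]

/-- The Maurer-Cartan equation `dA = [A, A]` at a point, for a one-form `A` with values in a space
with a bracket `br`. -/
def IsFlatAt (br : E → E → E) (A : S → S →L[ℝ] E) (z : S) : Prop :=
  ∀ v w, fderiv ℝ A z v w - fderiv ℝ A z w v = br (A z v) (A z w)

/-- The density of the Wess-Zumino-Witten action in the directions `v`, `w`, for a one-form `A`
that stands for `du u⁻¹` and a family `B` of two-forms that stands for the Wess-Zumino primitive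
along `u`. -/
def wzwDensity (β : E →L[ℝ] E →L[ℝ] ℝ) (A : S → S →L[ℝ] E) (B : S → E [⋀^Fin 2]→L[ℝ] ℝ) (v w : S)
    (z : S) : ℝ :=
  1 / 2 * β (A z v) (A z w) + 1 / 12 * B z ![A z v, A z w]

/-- The Wess-Zumino-Witten density with the term that the one-form `C = dk k⁻¹` of a gauge
transformation `k` contributes to it through the Lagrange multiplier. -/
def gaugedDensity (β : E →L[ℝ] E →L[ℝ] ℝ) (A C : S → S →L[ℝ] E) (B : S → E [⋀^Fin 2]→L[ℝ] ℝ)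
    (v w : S) (z : S) : ℝ :=
  wzwDensity β A B w v z - β (C z v) (A z w)

variable {β : E →L[ℝ] E →L[ℝ] ℝ} {A C : S → S →L[ℝ] E} {B : S → E [⋀^Fin 2]→L[ℝ] ℝ} {z : S}

theorem fderiv_bilin_apply (β : E →L[ℝ] E →L[ℝ] ℝ) (hA : DifferentiableAt ℝ A z)
    (hC : DifferentiableAt ℝ C z) (v w e : S) :
    fderiv ℝ (fun y => β (A y v) (C y w)) z e =
      β (fderiv ℝ A z e v) (C z w) + β (A z v) (fderiv ℝ C z e w) := by
  have hA' := hA.hasFDerivAt.clm_apply (hasFDerivAt_const v z)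
  have hC' := hC.hasFDerivAt.clm_apply (hasFDerivAt_const w z)
  rw [(β.hasFDerivAt_of_bilinear hA' hC').fderiv]
  simp [add_comm]

section Smoothness

variable {n : WithTop ℕ∞} (hA : ContDiffAt ℝ n A z) (hB : ContDiffAt ℝ n B z)

theorem contDiffAt_bilin_apply (β : E →L[ℝ] E →L[ℝ] ℝ) (hA : ContDiffAt ℝ n A z)
    (hC : ContDiffAt ℝ n C z) (v w : S) : ContDiffAt ℝ n (fun y => β (A y v) (C y w)) z :=
  (β.contDiff.contDiffAt.comp z (hA.clm_apply contDiffAt_const)).clm_apply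
    (hC.clm_apply contDiffAt_const)

include hA hB

theorem contDiffAt_twoForm_apply (v w : S) :
    ContDiffAt ℝ n (fun y => B y ![A y v, A y w]) z := by
  refine contDiffAt_alternatingMap_apply hB (contDiffAt_pi.2 fun i => ?_)
  fin_cases i
  · exact hA.clm_apply contDiffAt_const
  · exact hA.clm_apply contDiffAt_const

theorem contDiffAt_wzwDensity (v w : S) : ContDiffAt ℝ n (wzwDensity β A B v w) z :=
  (contDiffAt_const.mul (contDiffAt_bilin_apply β hA hA v w)).add
    (contDiffAt_const.mul (contDiffAt_twoForm_apply hA hB v w))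

theorem contDiffAt_gaugedDensity (hC : ContDiffAt ℝ n C z) (v w : S) :
    ContDiffAt ℝ n (gaugedDensity β A C B v w) z :=
  (contDiffAt_wzwDensity hA hB w v).sub (contDiffAt_bilin_apply β hC hA v w)

end Smoothness

theorem fderiv_wzwDensity (hA : ContDiffAt ℝ 1 A z) (hB : ContDiffAt ℝ 1 B z) (v w e : S) :
    fderiv ℝ (wzwDensity β A B v w) z e =
      1 / 2 * (β (fderiv ℝ A z e v) (A z w) + β (A z v) (fderiv ℝ A z e w)) +
        1 / 12 * fderiv ℝ (fun y => B y ![A y v, A y w]) z e := by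
  have hA' := hA.differentiableAt one_ne_zero
  have hβ := (contDiffAt_bilin_apply β hA hA v w).differentiableAt one_ne_zero
  have hη := (contDiffAt_twoForm_apply hA hB v w).differentiableAt one_ne_zero
  have h := (hβ.hasFDerivAt.const_mul (1 / 2)).add (hη.hasFDerivAt.const_mul (1 / 12))
  rw [← fderiv_bilin_apply β hA' hA']
  exact DFunLike.congr_fun h.fderiv e

theorem fderiv_wzwDensity_add_sub {br : E → E → E} (hβ : ∀ X Y, β X Y = β Y X)
    (hbr : ∀ X Y, br X Y = -br Y X) (hβbr : ∀ X Y Z, β (br X Y) Z = β X (br Y Z))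
    (hA : ContDiffAt ℝ 1 A z) (hB : ContDiffAt ℝ 1 B z) (hflat : IsFlatAt br A z) {v w e : S}
    (hη : extDeriv (fun y => (B y).compContinuousLinearMap (A y)) z ![e, w, v] =
      6 * β (A z e) (br (A z w) (A z v))) :
    fderiv ℝ (wzwDensity β A B w v) z e + fderiv ℝ (wzwDensity β A B e w) z v -
      fderiv ℝ (wzwDensity β A B e v) z w = β (fderiv ℝ A z v e) (A z w) := by
  have hpull : ∀ x y, (fun p => (B p).compContinuousLinearMap (A p) ![x, y]) =
      fun p => B p ![A p x, A p y] := fun x y => by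
    ext p
    simp only [ContinuousAlternatingMap.compContinuousLinearMap_apply]
    congr 1
    ext i
    fin_cases i <;> rfl
  have hd : DifferentiableAt ℝ (fun y => (B y).compContinuousLinearMap (A y)) z :=
    (hB.differentiableAt one_ne_zero).continuousAlternatingMapCompContinuousLinearMap
      (hA.differentiableAt one_ne_zero)
  rw [extDeriv_apply_three hd, hpull, hpull, hpull] at hη
  have hew : fderiv ℝ A z e w = br (A z e) (A z w) + fderiv ℝ A z w e :=
    sub_eq_iff_eq_add.1 (hflat e w)
  have hev : fderiv ℝ A z e v = br (A z e) (A z v) + fderiv ℝ A z v e :=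
    sub_eq_iff_eq_add.1 (hflat e v)
  have hvw : fderiv ℝ A z v w = br (A z v) (A z w) + fderiv ℝ A z w v :=
    sub_eq_iff_eq_add.1 (hflat v w)
  have hinv : β (br (A z e) (A z w)) (A z v) = -β (A z w) (br (A z e) (A z v)) := by
    rw [hbr, map_neg, neg_apply, hβbr]
  have hskew : β (A z e) (br (A z v) (A z w)) = -β (A z e) (br (A z w) (A z v)) := by
    rw [hbr, map_neg]
  simp only [fderiv_wzwDensity hA hB, hew, hev, hvw, map_add, add_apply, hinv, hskew]
  linear_combination (1 / 12) * hη + 1 / 2 * hβ (A z w) (fderiv ℝ A z v e)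

theorem fderiv_gaugedDensity {br : E → E → E} (hβ : ∀ X Y, β X Y = β Y X)
    (hbr : ∀ X Y, br X Y = -br Y X) (hβbr : ∀ X Y Z, β (br X Y) Z = β X (br Y Z))
    (hA : ContDiffAt ℝ 1 A z) (hB : ContDiffAt ℝ 1 B z) (hC : ContDiffAt ℝ 1 C z)
    (hAflat : IsFlatAt br A z) (hCflat : IsFlatAt br C z) {v w e : S}
    (hη : extDeriv (fun y => (B y).compContinuousLinearMap (A y)) z ![e, w, v] =
      6 * β (A z e) (br (A z w) (A z v)))
    (hAC : (fun y => A y e) =ᶠ[𝓝 z] fun y => C y e)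
    (hiso : ∀ᶠ y in 𝓝 z, β (C z v) (C y e) = 0) :
    fderiv ℝ (gaugedDensity β A C B v w) z e =
      fderiv ℝ (fun y => -wzwDensity β A B e w y) z v + fderiv ℝ (wzwDensity β A B e v) z w := by
  have hA' := hA.differentiableAt one_ne_zero
  have hC' := hC.differentiableAt one_ne_zero
  have hdiff := fderiv_wzwDensity_add_sub hβ hbr hβbr hA hB hAflat hη
  have hAC' : ∀ x, fderiv ℝ A z x e = fderiv ℝ C z x e := fun x => by
    rw [← fderiv_clm_apply_const hA', hAC.fderiv_eq, fderiv_clm_apply_const hC']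
  have hew : fderiv ℝ A z e w = br (A z e) (A z w) + fderiv ℝ A z w e :=
    sub_eq_iff_eq_add.1 (hAflat e w)
  have hev : fderiv ℝ C z e v = br (A z e) (C z v) + fderiv ℝ A z v e := by
    have hz : A z e = C z e := hAC.self_of_nhds
    rw [hAC', hz, sub_eq_iff_eq_add.1 (hCflat e v)]
  have hinv : β (br (A z e) (C z v)) (A z w) = -β (C z v) (br (A z e) (A z w)) := by
    rw [hbr, map_neg, neg_apply, hβbr]
  have hiso' : β (C z v) (fderiv ℝ A z w e) = 0 := by
    have h := (β (C z v)).hasFDerivAt.comp z (hC'.hasFDerivAt.clm_apply (hasFDerivAt_const e z))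
    have h₀ := h.unique ((hasFDerivAt_const (0 : ℝ) z).congr_of_eventuallyEq hiso)
    simpa [hAC'] using DFunLike.congr_fun h₀ w
  have hwzw := (contDiffAt_wzwDensity (β := β) hA hB w v).differentiableAt one_ne_zero
  have hmul := (contDiffAt_bilin_apply β hC hA v w).differentiableAt one_ne_zero
  have h := DFunLike.congr_fun (hwzw.hasFDerivAt.sub hmul.hasFDerivAt).fderiv e
  simp only [sub_apply, fderiv_bilin_apply β hC' hA', hew, hev, map_add, add_apply, hinv,
    hiso'] at h
  rw [fderiv_fun_neg, neg_apply]
  refine h.trans ?_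
  linear_combination hdiff

/-- To be applied to `A = du u⁻¹` and `C = dk k⁻¹`, where `u = k l` is a deformation of a field `l`
that does not depend on the parameter. -/
theorem setIntegral_gaugedDensity_eq [FiniteDimensional ℝ X] [MeasurableSpace X] [BorelSpace X]
    {μ : Measure X} [μ.IsAddHaarMeasure] {br : E → E → E} (hβ : ∀ X Y, β X Y = β Y X)
    (hbr : ∀ X Y, br X Y = -br Y X) (hβbr : ∀ X Y Z, β (br X Y) Z = β X (br Y Z)) {U W : Set X}
    (hU : IsOpen U) (hW : IsCompact W) (hWU : W ⊆ U) {A C : ℝ × X → ℝ × X →L[ℝ] E}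
    {B : ℝ × X → E [⋀^Fin 2]→L[ℝ] ℝ} {v w : X}
    (hA : ∀ z ∈ Set.univ ×ˢ U, ContDiffAt ℝ 1 A z) (hB : ∀ z ∈ Set.univ ×ˢ U, ContDiffAt ℝ 1 B z)
    (hC : ∀ z ∈ Set.univ ×ˢ U, ContDiffAt ℝ 1 C z) (hAflat : ∀ z ∈ Set.univ ×ˢ U, IsFlatAt br A z)
    (hCflat : ∀ z ∈ Set.univ ×ˢ U, IsFlatAt br C z)
    (hη : ∀ z ∈ Set.univ ×ˢ U, extDeriv (fun y => (B y).compContinuousLinearMap (A y)) z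
      ![(1, 0), (0, w), (0, v)] = 6 * β (A z (1, 0)) (br (A z (0, w)) (A z (0, v))))
    (hAC : ∀ z ∈ Set.univ ×ˢ U, A z (1, 0) = C z (1, 0))
    (hiso : ∀ z ∈ Set.univ ×ˢ U, ∀ y ∈ Set.univ ×ˢ U, β (C z (0, v)) (C y (1, 0)) = 0)
    (hC₀ : ∀ z : ℝ × X, z.2 ∈ U \ W → C z = 0) (r t : ℝ) :
    ∫ x in W, gaugedDensity β A C B (0, v) (0, w) (t, x) ∂μ =
      ∫ x in W, gaugedDensity β A C B (0, v) (0, w) (r, x) ∂μ := by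
  have hnhds : ∀ z ∈ Set.univ ×ˢ U, ∀ᶠ y : ℝ × X in 𝓝 z, y ∈ Set.univ ×ˢ U := fun z hz =>
    (isOpen_univ.prod hU).mem_nhds hz
  have hzero : ∀ z : ℝ × X, z.2 ∈ U \ W → ∀ x, wzwDensity β A B (1, 0) x z = 0 := by
    intro z hz x
    have hAz : A z (1, 0) = 0 := by rw [hAC z ⟨trivial, hz.1⟩, hC₀ z hz, zero_apply]
    have hBz : B z ![0, A z x] = 0 := (B z).map_coord_zero 0 rfl
    simp [wzwDensity, hAz, hBz]
  refine setIntegral_eq_of_fderiv_eq_divergence hU hW hWU (v := v) (w := w)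
    (a := fun z => -wzwDensity β A B (1, 0) (0, w) z) (b := wzwDensity β A B (1, 0) (0, v))
    (fun z hz => contDiffAt_gaugedDensity (hA z hz) (hB z hz) (hC z hz) _ _)
    (fun z hz => (contDiffAt_wzwDensity (hA z hz) (hB z hz) _ _).neg)
    (fun z hz => contDiffAt_wzwDensity (hA z hz) (hB z hz) _ _)
    (fun z hz => by rw [hzero z hz, neg_zero]) (fun z hz => hzero z hz _) (fun z hz => ?_) r t
  refine fderiv_gaugedDensity hβ hbr hβbr (hA z hz) (hB z hz) (hC z hz) (hAflat z hz)
    (hCflat z hz) (hη z hz) ?_ ?_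
  · filter_upwards [hnhds z hz] with y hy using hAC y hy
  · filter_upwards [hnhds z hz] with y hy using hiso z hz y hy

end WessZumino

section GaugeTransformation

open Filter Topology

variable {E : Type*} [NormedAddCommGroup E] [NormedSpace ℝ E]
  {D : Type*} [TopologicalSpace D] [ChartedSpace E D] [Group D]
  {S : Type*} [NormedAddCommGroup S] [NormedSpace ℝ S]

/-- An invariant form on the Lie algebra, as a continuous bilinear form on the model space. -/
def modelForm [FiniteDimensional ℝ E] (form : LinearMap.BilinForm ℝ (GroupLieAlgebra 𝓘(ℝ, E) D)) :
    E →L[ℝ] E →L[ℝ] ℝ :=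
  LinearMap.toContinuousBilinearMap (E := E) form

theorem modelBracket_skew [LieGroup 𝓘(ℝ, E) ∞ D] (X Y : E) :
    modelBracket E D X Y = -modelBracket E D Y X := by
  rw [modelBracket_eq, modelBracket_eq, neg_sub]

theorem rightDeriv_slice [LieGroup 𝓘(ℝ, E) ∞ D] {u : ℝ × S → D} {s : ℝ} {x : S}
    (hu : MDifferentiableAt 𝓘(ℝ, ℝ × S) 𝓘(ℝ, E) u (s, x)) (v : S) :
    rightDeriv E (fun y => u (s, y)) x v = rightDeriv E u (s, x) (0, v) := by
  have hs := hasFDerivAt_prodMk_right (𝕜 := ℝ) s x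
  rw [rightDeriv_comp (g := fun y => (s, y)) hu hs.differentiableAt, hs.fderiv]
  rfl

theorem gaugedDensity_slice [LieGroup 𝓘(ℝ, E) ∞ D] {β : E →L[ℝ] E →L[ℝ] ℝ}
    {b : D → E [⋀^Fin 2]→L[ℝ] ℝ} {u k : ℝ × S → D} {s : ℝ} {x : S}
    (hu : MDifferentiableAt 𝓘(ℝ, ℝ × S) 𝓘(ℝ, E) u (s, x))
    (hk : MDifferentiableAt 𝓘(ℝ, ℝ × S) 𝓘(ℝ, E) k (s, x)) (v w : S) :
    gaugedDensity β (rightDeriv E fun y => u (s, y)) (rightDeriv E fun y => k (s, y))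
        (fun y => b (u (s, y))) v w x =
      gaugedDensity β (rightDeriv E u) (rightDeriv E k) (fun z => b (u z)) (0, v) (0, w)
        (s, x) := by
  simp only [gaugedDensity, wzwDensity, rightDeriv_slice hu, rightDeriv_slice hk]

section Lagrangian

variable {form : LinearMap.BilinForm ℝ (GroupLieAlgebra 𝓘(ℝ, E) D)}
  {b : D → E [⋀^Fin 2]→L[ℝ] ℝ} {K : E → ℝ} {F : Type*} [Group F] {ι : F →* D}
  {f g : ℝ × ℝ → F} {l : ℝ × ℝ → D} {Λ : ℝ × ℝ → E} {x : ℝ × ℝ}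

theorem lagrangian_gauge_congr (hfg : f =ᶠ[𝓝 x] g) :
    lagrangian form b K (gaugeField ι f l) (gaugeMultiplier ι f Λ) x =
      lagrangian form b K (gaugeField ι g l) (gaugeMultiplier ι g Λ) x := by
  have hl : gaugeField ι f l =ᶠ[𝓝 x] gaugeField ι g l := by
    filter_upwards [hfg] with y hy
    simp only [gaugeField, hy]
  have hdl : rightLogDeriv E (gaugeField ι f l) x = rightLogDeriv E (gaugeField ι g l) x :=
    rightDeriv_congr hl
  have hdf : rightLogDeriv E (fun y => ι (f y)) x = rightLogDeriv E (fun y => ι (g y)) x :=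
    rightDeriv_congr (hfg.fun_comp ι)
  simp only [lagrangian, gaugeMultiplier, dτ, dσ, hdl, hdf, hl.self_of_nhds, hfg.self_of_nhds]

omit [TopologicalSpace D] [ChartedSpace E D] in
theorem gaugeField_one : gaugeField ι 1 l = l := by
  ext y
  simp [gaugeField]

theorem lagrangian_eq [FiniteDimensional ℝ E] (hsymm : ∀ X Y, form X Y = form Y X) :
    lagrangian form b K l Λ x =
      wzwDensity (modelForm form) (rightDeriv E l) (fun y => b (l y)) (0, 1) (1, 0) x +
        1 / 2 * K (rightDeriv E l x (0, 1)) + modelForm form (Λ x) (rightDeriv E l x (0, 1)) := by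
  have hβ : ∀ X Y : E, modelForm form X Y = modelForm form Y X := hsymm
  rw [wzwDensity, hβ]
  rfl

variable [LieGroup 𝓘(ℝ, E) ∞ D]

theorem gaugeMultiplier_one : gaugeMultiplier ι 1 Λ = Λ := by
  ext y
  suffices h : adjoint E (ι 1) (Λ y) - rightDeriv E (fun _ => ι 1) y (1, 0) = Λ y from h
  simp [adjoint_one, rightDeriv_const]

theorem rightDeriv_gaugeField (hf : MDifferentiableAt 𝓘(ℝ, ℝ × ℝ) 𝓘(ℝ, E) (fun y => ι (f y)) x)
    (hl : MDifferentiableAt 𝓘(ℝ, ℝ × ℝ) 𝓘(ℝ, E) l x) (v : ℝ × ℝ) :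
    rightDeriv E (gaugeField ι f l) x v =
      rightDeriv E (fun y => ι (f y)) x v + adjoint E (ι (f x)) (rightDeriv E l x v) :=
  DFunLike.congr_fun (rightDeriv_mul hf hl) v

theorem isAdjointPair_Ad (hAd : ∀ (g : D) X Y, form (Ad E g X) (Ad E g Y) = form X Y) (g : F) :
    form.IsAdjointPair form (Ad E (ι g⁻¹)).toLinearMap (Ad E (ι g)).toLinearMap := fun X Y => by
  have hcancel : Ad E (ι g) (Ad E (ι g⁻¹) X) = X := by
    rw [map_inv]
    exact adjoint_apply_adjoint_inv (E := E) (ι g) X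
  have hinv := hAd (ι g) (Ad E (ι g⁻¹) X) Y
  rw [hcancel] at hinv
  exact hinv.symm

variable [FiniteDimensional ℝ E]

theorem lagrangian_gauge {ℱ : Submodule ℝ E} (hsymm : ∀ X Y, form X Y = form Y X)
    (hAd : ∀ (g : D) X Y, form (Ad E g X) (Ad E g Y) = form X Y)
    (hiso : ∀ X ∈ ℱ, ∀ Y ∈ ℱ, form X Y = 0) (hAdF : ∀ (g : F), ∀ X ∈ ℱ, adjoint E (ι g) X ∈ ℱ)
    (hf : MDifferentiableAt 𝓘(ℝ, ℝ × ℝ) 𝓘(ℝ, E) (fun y => ι (f y)) x)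
    (hl : MDifferentiableAt 𝓘(ℝ, ℝ × ℝ) 𝓘(ℝ, E) l x)
    (hfF : ∀ v, rightDeriv E (fun y => ι (f y)) x v ∈ ℱ) (hΛ : Λ x ∈ ℱ)
    (hK : ∀ (g : F), ∀ Y ∈ ℱ,
      K (Y + adjoint E (ι g) (rightDeriv E l x (0, 1))) = K (rightDeriv E l x (0, 1))) :
    lagrangian form b K (gaugeField ι f l) (gaugeMultiplier ι f Λ) x =
      gaugedDensity (modelForm form) (rightDeriv E (gaugeField ι f l))
          (rightDeriv E fun y => ι (f y)) (fun y => b (gaugeField ι f l y)) (1, 0) (0, 1) x +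
        (1 / 2 * K (rightDeriv E l x (0, 1)) +
          modelForm form (Λ x) (rightDeriv E l x (0, 1))) := by
  have hβAd : ∀ (g : D) (X Y : E),
      modelForm form (adjoint E g X) (adjoint E g Y) = modelForm form X Y := hAd
  have hβiso : ∀ X ∈ ℱ, ∀ Y ∈ ℱ, modelForm form X Y = 0 := hiso
  have hσ := rightDeriv_gaugeField hf hl (0, 1)
  have hΛσ : modelForm form (gaugeMultiplier ι f Λ x) (rightDeriv E (gaugeField ι f l) x (0, 1)) =
      modelForm form (Λ x) (rightDeriv E l x (0, 1)) -
        modelForm form (rightDeriv E (fun y => ι (f y)) x (1, 0))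
          (rightDeriv E (gaugeField ι f l) x (0, 1)) := by
    have hΛ' : (gaugeMultiplier ι f Λ x : E) =
        adjoint E (ι (f x)) (Λ x) - rightDeriv E (fun y => ι (f y)) x (1, 0) := rfl
    rw [hΛ', map_sub, sub_apply, sub_left_inj, hσ, map_add,
      hβiso _ (hAdF _ _ hΛ) _ (hfF _), zero_add, hβAd]
  refine (lagrangian_eq hsymm).trans ?_
  rw [hΛσ, gaugedDensity, hσ, hK _ _ (hfF _)]
  ring

end Lagrangian

section Deformation

variable [LieGroup 𝓘(ℝ, E) ∞ D] {form : LinearMap.BilinForm ℝ (GroupLieAlgebra 𝓘(ℝ, E) D)}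
  {b : D → E [⋀^Fin 2]→L[ℝ] ℝ} {U W : Set (ℝ × ℝ)} {l : ℝ × ℝ → D}

omit [LieGroup 𝓘(ℝ, E) ∞ D] in
theorem rightDeriv_eq_zero_of_eqOn_one {u : S → D} {O : Set S} (hO : IsOpen O)
    (hu : ∀ y ∈ O, u y = 1) {x : S} (hx : x ∈ O) : rightDeriv E u x = 0 := by
  rw [rightDeriv_congr (eventuallyEq_of_mem (hO.mem_nhds hx) hu), rightDeriv_const]

theorem contMDiffOn_mul_comp_snd {k : ℝ × S → D} {l : S → D} {U : Set S}
    (hk : ContMDiffOn 𝓘(ℝ, ℝ × S) 𝓘(ℝ, E) ∞ k (Set.univ ×ˢ U))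
    (hl : ContMDiffOn 𝓘(ℝ, S) 𝓘(ℝ, E) ∞ l U) :
    ContMDiffOn 𝓘(ℝ, ℝ × S) 𝓘(ℝ, E) ∞ (fun z => k z * l z.2) (Set.univ ×ˢ U) :=
  hk.mul (ContMDiffOn.comp (g := l) hl contDiff_snd.contMDiff.contMDiffOn fun _ hz => hz.2)

theorem rightDeriv_mul_comp_snd_inl {k : ℝ × S → D} {l : S → D} {z : ℝ × S}
    (hk : MDifferentiableAt 𝓘(ℝ, ℝ × S) 𝓘(ℝ, E) k z)
    (hl : MDifferentiableAt 𝓘(ℝ, S) 𝓘(ℝ, E) l z.2) (s : ℝ) :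
    rightDeriv E (fun z => k z * l z.2) z (s, 0) = rightDeriv E k z (s, 0) := by
  have hsnd : MDifferentiableAt 𝓘(ℝ, ℝ × S) 𝓘(ℝ, S) (Prod.snd : ℝ × S → S) z :=
    differentiableAt_snd.mdifferentiableAt
  have hls : MDifferentiableAt 𝓘(ℝ, ℝ × S) 𝓘(ℝ, E) (fun z : ℝ × S => l z.2) z := hl.comp z hsnd
  rw [rightDeriv_mul hk hls, rightDeriv_comp (g := Prod.snd) hl differentiableAt_snd]
  simp [fderiv_snd]

variable [FiniteDimensional ℝ E]

theorem contDiffAt_gaugedDensity_rightDeriv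
    (hb : ContMDiff 𝓘(ℝ, E) 𝓘(ℝ, E [⋀^Fin 2]→L[ℝ] ℝ) ∞ b) {u k : S → D} {z : S}
    (hu : ContMDiffAt 𝓘(ℝ, S) 𝓘(ℝ, E) ∞ u z) (hk : ContMDiffAt 𝓘(ℝ, S) 𝓘(ℝ, E) ∞ k z) (v w : S) :
    ContDiffAt ℝ ∞ (gaugedDensity (modelForm form) (rightDeriv E u) (rightDeriv E k)
      (fun y => b (u y)) v w) z :=
  contDiffAt_gaugedDensity (contDiffAt_rightDeriv hu) (hb.contMDiffAt.comp z hu).contDiffAt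
    (contDiffAt_rightDeriv hk) v w

theorem setIntegral_gaugedDensity_rightDeriv_eq (hsymm : ∀ X Y, form X Y = form Y X)
    (had : ∀ X Y Z, form ⁅X, Y⁆ Z = form X ⁅Y, Z⁆) (hb : IsWZPrimitive form b) {ℱ : Submodule ℝ E}
    (hiso : ∀ X ∈ ℱ, ∀ Y ∈ ℱ, form X Y = 0) (hU : IsOpen U) (hW : IsCompact W) (hWU : W ⊆ U)
    {k : ℝ × ℝ × ℝ → D} (hk : ContMDiffOn 𝓘(ℝ, ℝ × ℝ × ℝ) 𝓘(ℝ, E) ∞ k (Set.univ ×ˢ U))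
    (hl : ContMDiffOn 𝓘(ℝ, ℝ × ℝ) 𝓘(ℝ, E) ∞ l U)
    (hkF : ∀ z ∈ Set.univ ×ˢ U, ∀ v, rightDeriv E k z v ∈ ℱ)
    (hk₁ : ∀ z : ℝ × ℝ × ℝ, z.2 ∈ U \ W → k z = 1) (r t : ℝ) :
    ∫ x in W, gaugedDensity (modelForm form) (rightDeriv E fun z => k z * l z.2) (rightDeriv E k)
        (fun z => b (k z * l z.2)) (0, 1, 0) (0, 0, 1) (t, x) =
      ∫ x in W, gaugedDensity (modelForm form) (rightDeriv E fun z => k z * l z.2) (rightDeriv E k)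
        (fun z => b (k z * l z.2)) (0, 1, 0) (0, 0, 1) (r, x) := by
  have hZ : IsOpen (Set.univ ×ˢ U : Set (ℝ × ℝ × ℝ)) := isOpen_univ.prod hU
  have hu := contMDiffOn_mul_comp_snd hk hl
  have hkAt := fun z hz => hk.contMDiffAt (x := z) (hZ.mem_nhds hz)
  have huAt := fun z hz => hu.contMDiffAt (x := z) (hZ.mem_nhds hz)
  have hlAt := fun x hx => hl.contMDiffAt (x := x) (hU.mem_nhds hx)
  have hβ : ∀ X Y : E, modelForm form X Y = modelForm form Y X := hsymm
  have hβad : ∀ X Y Z : E, modelForm form (modelBracket E D X Y) Z =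
      modelForm form X (modelBracket E D Y Z) := had
  have hβiso : ∀ X ∈ ℱ, ∀ Y ∈ ℱ, modelForm form X Y = 0 := hiso
  refine setIntegral_gaugedDensity_eq (B := fun z => b (k z * l z.2)) (v := (1, 0)) (w := (0, 1))
    hβ modelBracket_skew hβad hU hW hWU
    (fun z hz => (contDiffAt_rightDeriv (huAt z hz)).of_le (by simp))
    (fun z hz => ((hb.1.contMDiffAt.comp z (huAt z hz)).contDiffAt).of_le (by simp))
    (fun z hz => (contDiffAt_rightDeriv (hkAt z hz)).of_le (by simp))
    (fun z hz => maurerCartan (huAt z hz)) (fun z hz => maurerCartan (hkAt z hz))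
    (fun z hz => hb.2 _ _ hZ hu z hz ![(1, 0), (0, 0, 1), (0, 1, 0)]) (fun z hz => ?_)
    (fun z hz y hy => hβiso _ (hkF z hz _) _ (hkF y hy _)) (fun z hz => ?_) r t
  · exact rightDeriv_mul_comp_snd_inl ((hkAt z hz).mdifferentiableAt (by simp))
      ((hlAt z.2 hz.2).mdifferentiableAt (by simp)) 1
  · have hO : IsOpen (Set.univ ×ˢ (U \ W) : Set (ℝ × ℝ × ℝ)) :=
      isOpen_univ.prod (hU.sdiff hW.isClosed)
    exact rightDeriv_eq_zero_of_eqOn_one hO (fun y hy => hk₁ y hy.2) ⟨trivial, hz⟩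

end Deformation

section Invariance

variable {E₁ : Type*} [NormedAddCommGroup E₁] [NormedSpace ℝ E₁]
  {F : Type*} [TopologicalSpace F] [ChartedSpace E₁ F] [Group F]

/-- The properties of a homomorphism `ι : F → D` and of an invariant form on the Lie algebra of `D`
under which the first-order action has gauge symmetry `F`: the derivative of `ι` takes values in an
isotropic subspace `ℱ` that is stable under the adjoint action of `F`. -/
structure IsGaugeGroup (form : LinearMap.BilinForm ℝ (GroupLieAlgebra 𝓘(ℝ, E) D)) (ι : F →* D)
    (ℱ : Submodule ℝ E) : Prop where
  symm : ∀ X Y, form X Y = form Y X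
  invariant_Ad : ∀ (g : D) X Y, form (Ad E g X) (Ad E g Y) = form X Y
  invariant_ad : ∀ X Y Z, form ⁅X, Y⁆ Z = form X ⁅Y, Z⁆
  contMDiff : ContMDiff 𝓘(ℝ, E₁) 𝓘(ℝ, E) ∞ ι
  mfderiv_mem : ∀ Y : GroupLieAlgebra 𝓘(ℝ, E₁) F, mfderiv 𝓘(ℝ, E₁) 𝓘(ℝ, E) ι 1 Y ∈ ℱ
  isotropic : ∀ X ∈ ℱ, ∀ Y ∈ ℱ, form X Y = 0
  adjoint_mem : ∀ (g : F), ∀ X ∈ ℱ, adjoint E (ι g) X ∈ ℱ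

variable {form : LinearMap.BilinForm ℝ (GroupLieAlgebra 𝓘(ℝ, E) D)}
  {b : D → E [⋀^Fin 2]→L[ℝ] ℝ} {K : E → ℝ} {ι : F →* D} {ℱ : Submodule ℝ E}
  {U W : Set (ℝ × ℝ)} {f : ℝ × ℝ → F} {h : ℝ × ℝ × ℝ → F} {l : ℝ × ℝ → D} {Λ : ℝ × ℝ → E}

theorem IsGaugeGroup.rightDeriv_mem [LieGroup 𝓘(ℝ, E₁) ∞ F]
    (hG : IsGaugeGroup (E₁ := E₁) form ι ℱ) {g : S → F} {x : S}
    (hg : ContMDiffAt 𝓘(ℝ, S) 𝓘(ℝ, E₁) ∞ g x) (v : S) :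
    rightDeriv E (fun y => ι (g y)) x v ∈ ℱ := by
  rw [rightDeriv_map (hG.contMDiff.mdifferentiableAt (by simp))
    (hg.mdifferentiableAt (by simp))]
  exact hG.mfderiv_mem _

theorem gaugeMultiplier_mem [LieGroup 𝓘(ℝ, E₁) ∞ F] (hG : IsGaugeGroup (E₁ := E₁) form ι ℱ)
    {x : ℝ × ℝ} (hf : ContMDiffAt 𝓘(ℝ, ℝ × ℝ) 𝓘(ℝ, E₁) ∞ f x) (hΛ : Λ x ∈ ℱ) :
    gaugeMultiplier ι f Λ x ∈ ℱ :=
  sub_mem (hG.adjoint_mem _ _ hΛ) (hG.rightDeriv_mem hf (1, 0))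

theorem IsGaugeTransformation.contMDiffOn
    (hf : IsGaugeTransformation (E₁ := E₁) U W f) : ContMDiffOn 𝓘(ℝ, ℝ × ℝ) 𝓘(ℝ, E₁) ∞ f U := by
  obtain ⟨h, hh, -, hh₁, -⟩ := hf
  have hpair : ContMDiffOn 𝓘(ℝ, ℝ × ℝ) 𝓘(ℝ, ℝ × ℝ × ℝ) ∞ (fun y : ℝ × ℝ => ((1 : ℝ), y)) U :=
    (contDiff_prodMk_right 1).contMDiff.contMDiffOn
  exact (ContMDiffOn.comp (g := h) hh hpair fun x hx => ⟨trivial, hx⟩).congr fun x hx =>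
    (hh₁ x hx).symm

variable [LieGroup 𝓘(ℝ, E) ∞ D]

theorem IsGaugeGroup.Ad_mem_orthogonal_iff (hG : IsGaugeGroup (E₁ := E₁) form ι ℱ) (g : F)
    {X : GroupLieAlgebra 𝓘(ℝ, E) D} :
    Ad E (ι g) X ∈ form.orthogonal ℱ ↔ X ∈ form.orthogonal ℱ := by
  refine map_mem_orthogonal_iff (isAdjointPair_Ad hG.invariant_Ad g) (fun X => ?_)
    (hG.adjoint_mem g) (hG.adjoint_mem g⁻¹)
  have h := adjoint_apply_adjoint_inv (ι g⁻¹) (E := E) X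
  rwa [map_inv, inv_inv, ← map_inv] at h

theorem dσ_gaugeField_mem_orthogonal_iff [LieGroup 𝓘(ℝ, E₁) ∞ F]
    (hG : IsGaugeGroup (E₁ := E₁) form ι ℱ) {x : ℝ × ℝ}
    (hf : ContMDiffAt 𝓘(ℝ, ℝ × ℝ) 𝓘(ℝ, E₁) ∞ f x) (hl : ContMDiffAt 𝓘(ℝ, ℝ × ℝ) 𝓘(ℝ, E) ∞ l x) :
    dσ E (gaugeField ι f l) x ∈ form.orthogonal ℱ ↔ dσ E l x ∈ form.orthogonal ℱ := by
  have hιf : ContMDiffAt 𝓘(ℝ, ℝ × ℝ) 𝓘(ℝ, E) ∞ (fun y => ι (f y)) x :=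
    hG.contMDiff.contMDiffAt.comp x hf
  have hσ : dσ E (gaugeField ι f l) x = dσ E (fun y => ι (f y)) x + Ad E (ι (f x)) (dσ E l x) :=
    rightDeriv_gaugeField (hιf.mdifferentiableAt (by simp)) (hl.mdifferentiableAt (by simp)) (0, 1)
  have hfσ : dσ E (fun y => ι (f y)) x ∈ form.orthogonal ℱ := fun X hX =>
    hG.isotropic X hX _ (hG.rightDeriv_mem hf (0, 1))
  rw [hσ, Submodule.add_mem_iff_right _ hfσ, hG.Ad_mem_orthogonal_iff]

variable [FiniteDimensional ℝ E]

theorem lagrangian_gauge_slice [LieGroup 𝓘(ℝ, E₁) ∞ F]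
    (hG : IsGaugeGroup (E₁ := E₁) form ι ℱ) {s : ℝ} {x : ℝ × ℝ}
    (hh : ContMDiffAt 𝓘(ℝ, ℝ × ℝ × ℝ) 𝓘(ℝ, E₁) ∞ h (s, x))
    (hl : ContMDiffAt 𝓘(ℝ, ℝ × ℝ) 𝓘(ℝ, E) ∞ l x) (hΛ : Λ x ∈ ℱ)
    (hK : ∀ (g : F), ∀ Y ∈ ℱ,
      K (Y + adjoint E (ι g) (rightDeriv E l x (0, 1))) = K (rightDeriv E l x (0, 1))) :
    lagrangian form b K (gaugeField ι (fun y => h (s, y)) l)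
        (gaugeMultiplier ι (fun y => h (s, y)) Λ) x =
      gaugedDensity (modelForm form) (rightDeriv E fun z => ι (h z) * l z.2)
          (rightDeriv E fun z => ι (h z)) (fun z => b (ι (h z) * l z.2)) (0, 1, 0) (0, 0, 1)
          (s, x) +
        (1 / 2 * K (rightDeriv E l x (0, 1)) +
          modelForm form (Λ x) (rightDeriv E l x (0, 1))) := by
  have hk : ContMDiffAt 𝓘(ℝ, ℝ × ℝ × ℝ) 𝓘(ℝ, E) ∞ (fun z => ι (h z)) (s, x) :=
    hG.contMDiff.contMDiffAt.comp (s, x) hh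
  have hu : ContMDiffAt 𝓘(ℝ, ℝ × ℝ × ℝ) 𝓘(ℝ, E) ∞ (fun z => ι (h z) * l z.2) (s, x) :=
    hk.mul (ContMDiffAt.comp (g := l) (s, x) hl contDiff_snd.contMDiff.contMDiffAt)
  have hpair : ContMDiffAt 𝓘(ℝ, ℝ × ℝ) 𝓘(ℝ, ℝ × ℝ × ℝ) ∞ (fun y : ℝ × ℝ => (s, y)) x :=
    (contDiff_prodMk_right s).contMDiff.contMDiffAt
  have hf : ContMDiffAt 𝓘(ℝ, ℝ × ℝ) 𝓘(ℝ, E₁) ∞ (fun y => h (s, y)) x :=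
    ContMDiffAt.comp (g := h) x hh hpair
  have hιf : ContMDiffAt 𝓘(ℝ, ℝ × ℝ) 𝓘(ℝ, E) ∞ (fun y => ι (h (s, y))) x :=
    hG.contMDiff.contMDiffAt.comp x hf
  rw [lagrangian_gauge hG.symm hG.invariant_Ad hG.isotropic hG.adjoint_mem
    (hιf.mdifferentiableAt (by simp)) (hl.mdifferentiableAt (by simp)) (hG.rightDeriv_mem hf) hΛ hK]
  congr 1
  exact gaugedDensity_slice (hu.mdifferentiableAt (by simp)) (hk.mdifferentiableAt (by simp)) _ _

theorem integrableOn_multiplier_add (hU : IsOpen U) (hW : IsCompact W) (hWU : W ⊆ U)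
    (hl : ContMDiffOn 𝓘(ℝ, ℝ × ℝ) 𝓘(ℝ, E) ∞ l U) (hΛ : ContinuousOn Λ U)
    (hKc : ContinuousOn (fun x => K (rightDeriv E l x (0, 1))) U) :
    IntegrableOn (fun x => 1 / 2 * K (rightDeriv E l x (0, 1)) +
      modelForm form (Λ x) (rightDeriv E l x (0, 1))) W := by
  have hσ : ContinuousOn (fun x => rightDeriv E l x (0, 1)) U := fun x hx =>
    (continuousAt_rightDeriv_apply (hl.contMDiffAt (hU.mem_nhds hx)) (0, 1)).continuousWithinAt
  refine ContinuousOn.integrableOn_compact hW (ContinuousOn.mono ?_ hWU)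
  exact (continuousOn_const.mul hKc).add
    (((modelForm form).continuous.comp_continuousOn hΛ).clm_apply hσ)

theorem integrableOn_gaugedDensity_slice (hb : ContMDiff 𝓘(ℝ, E) 𝓘(ℝ, E [⋀^Fin 2]→L[ℝ] ℝ) ∞ b)
    (hU : IsOpen U) (hW : IsCompact W) (hWU : W ⊆ U) {u k : ℝ × ℝ × ℝ → D}
    (hu : ContMDiffOn 𝓘(ℝ, ℝ × ℝ × ℝ) 𝓘(ℝ, E) ∞ u (Set.univ ×ˢ U))
    (hk : ContMDiffOn 𝓘(ℝ, ℝ × ℝ × ℝ) 𝓘(ℝ, E) ∞ k (Set.univ ×ˢ U)) (v w : ℝ × ℝ × ℝ) (s : ℝ) :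
    IntegrableOn (fun x => gaugedDensity (modelForm form) (rightDeriv E u) (rightDeriv E k)
      (fun z => b (u z)) v w (s, x)) W := by
  refine ContinuousOn.integrableOn_compact hW fun x hx => ContinuousAt.continuousWithinAt ?_
  have hnhds : Set.univ ×ˢ U ∈ 𝓝 (s, x) := (isOpen_univ.prod hU).mem_nhds ⟨trivial, hWU hx⟩
  have hdensity := contDiffAt_gaugedDensity_rightDeriv (form := form) hb (hu.contMDiffAt hnhds)
    (hk.contMDiffAt hnhds) v w
  exact hdensity.continuousAt.comp (f := fun y => (s, y)) (by fun_prop)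

theorem action_gauge_slice_eq [LieGroup 𝓘(ℝ, E₁) ∞ F] (hG : IsGaugeGroup (E₁ := E₁) form ι ℱ)
    (hb : IsWZPrimitive form b) (hU : IsOpen U) (hW : IsCompact W) (hWU : W ⊆ U)
    (hh : ContMDiffOn 𝓘(ℝ, ℝ × ℝ × ℝ) 𝓘(ℝ, E₁) ∞ h (Set.univ ×ˢ U))
    (hhW : ∀ s, ∀ x ∈ U \ W, h (s, x) = 1)
    (hl : ContMDiffOn 𝓘(ℝ, ℝ × ℝ) 𝓘(ℝ, E) ∞ l U) (hΛ : ContinuousOn Λ U)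
    (hΛF : ∀ x ∈ U, Λ x ∈ ℱ) (hKc : ContinuousOn (fun x => K (rightDeriv E l x (0, 1))) U)
    (hK : ∀ x ∈ U, ∀ (g : F), ∀ Y ∈ ℱ,
      K (Y + adjoint E (ι g) (rightDeriv E l x (0, 1))) = K (rightDeriv E l x (0, 1))) :
    (∀ s, IntegrableOn (lagrangian form b K (gaugeField ι (fun y => h (s, y)) l)
        (gaugeMultiplier ι (fun y => h (s, y)) Λ)) W) ∧
      ∀ r s, action form b K W (gaugeField ι (fun y => h (s, y)) l)
          (gaugeMultiplier ι (fun y => h (s, y)) Λ) =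
        action form b K W (gaugeField ι (fun y => h (r, y)) l)
          (gaugeMultiplier ι (fun y => h (r, y)) Λ) := by
  have hk : ContMDiffOn 𝓘(ℝ, ℝ × ℝ × ℝ) 𝓘(ℝ, E) ∞ (fun z => ι (h z)) (Set.univ ×ˢ U) :=
    hG.contMDiff.comp_contMDiffOn hh
  have hhAt : ∀ z ∈ Set.univ ×ˢ U, ContMDiffAt 𝓘(ℝ, ℝ × ℝ × ℝ) 𝓘(ℝ, E₁) ∞ h z := fun z hz =>
    hh.contMDiffAt ((isOpen_univ.prod hU).mem_nhds hz)
  have hlag := fun s => fun x (hx : x ∈ W) => lagrangian_gauge_slice (b := b) hG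
    (hhAt (s, x) ⟨trivial, hWU hx⟩) (hl.contMDiffAt (hU.mem_nhds (hWU hx))) (hΛF x (hWU hx))
    (hK x (hWU hx))
  have hdensity := integrableOn_gaugedDensity_slice (form := form) hb.1 hU hW hWU
    (contMDiffOn_mul_comp_snd hk hl) hk (0, 1, 0) (0, 0, 1)
  have hbase := integrableOn_multiplier_add (form := form) hU hW hWU hl hΛ hKc
  refine ⟨fun s => ((hdensity s).add hbase).congr_fun (fun x hx => (hlag s x hx).symm)
    hW.measurableSet, fun r s => ?_⟩
  refine (setIntegral_congr_fun hW.measurableSet (hlag s)).trans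
    (Eq.trans ?_ (setIntegral_congr_fun hW.measurableSet (hlag r)).symm)
  rw [integral_add (hdensity s) hbase,
    integral_add (hdensity r) hbase, setIntegral_gaugedDensity_rightDeriv_eq hG.symm
      hG.invariant_ad hb hG.isotropic hU hW hWU hk hl (fun z hz => hG.rightDeriv_mem (hhAt z hz))
      (fun z hz => by rw [hhW z.1 z.2 hz, map_one]) r s]

theorem action_gauge_eq [LieGroup 𝓘(ℝ, E₁) ∞ F] (hG : IsGaugeGroup (E₁ := E₁) form ι ℱ)
    (hb : IsWZPrimitive form b) (hU : IsOpen U) (hW : IsCompact W) (hWU : W ⊆ U)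
    (hf : IsGaugeTransformation (E₁ := E₁) U W f)
    (hl : ContMDiffOn 𝓘(ℝ, ℝ × ℝ) 𝓘(ℝ, E) ∞ l U) (hΛ : ContinuousOn Λ U)
    (hΛF : ∀ x ∈ U, Λ x ∈ ℱ) (hKc : ContinuousOn (fun x => K (rightDeriv E l x (0, 1))) U)
    (hK : ∀ x ∈ U, ∀ (g : F), ∀ Y ∈ ℱ,
      K (Y + adjoint E (ι g) (rightDeriv E l x (0, 1))) = K (rightDeriv E l x (0, 1))) :
    IntegrableOn (lagrangian form b K l Λ) W ∧
      IntegrableOn (lagrangian form b K (gaugeField ι f l) (gaugeMultiplier ι f Λ)) W ∧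
      action form b K W (gaugeField ι f l) (gaugeMultiplier ι f Λ) = action form b K W l Λ := by
  obtain ⟨h, hh, hh₀, hh₁, hhW⟩ := hf
  obtain ⟨hint, haction⟩ := action_gauge_slice_eq hG hb hU hW hWU hh hhW hl hΛ hΛF hKc hK
  have hlag : ∀ (s : ℝ) (g : ℝ × ℝ → F), (∀ x ∈ U, h (s, x) = g x) → Set.EqOn
      (lagrangian form b K (gaugeField ι (fun y => h (s, y)) l)
        (gaugeMultiplier ι (fun y => h (s, y)) Λ))
      (lagrangian form b K (gaugeField ι g l) (gaugeMultiplier ι g Λ)) W := fun s g hg x hx =>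
    lagrangian_gauge_congr (eventuallyEq_of_mem (hU.mem_nhds (hWU hx)) hg)
  have hone := hlag 0 1 hh₀
  rw [gaugeField_one, gaugeMultiplier_one] at hone
  refine ⟨(hint 0).congr_fun hone hW.measurableSet,
    (hint 1).congr_fun (hlag 1 f hh₁) hW.measurableSet, ?_⟩
  calc action form b K W (gaugeField ι f l) (gaugeMultiplier ι f Λ)
    _ = action form b K W (gaugeField ι (fun y => h (1, y)) l)
          (gaugeMultiplier ι (fun y => h (1, y)) Λ) :=
      (setIntegral_congr_fun hW.measurableSet (hlag 1 f hh₁)).symm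
    _ = action form b K W (gaugeField ι (fun y => h (0, y)) l)
          (gaugeMultiplier ι (fun y => h (0, y)) Λ) := haction 0 1
    _ = action form b K W l Λ := setIntegral_congr_fun hW.measurableSet hone

end Invariance

end GaugeTransformation

section DressingCoset

variable {E : Type*} [NormedAddCommGroup E] [NormedSpace ℝ E]
  [CompleteSpace E] {D : Type*} [TopologicalSpace D] [ChartedSpace E D] [Group D]
  [LieGroup 𝓘(ℝ, E) ∞ D] {F : Type*} [Group F]
  {form : LinearMap.BilinForm ℝ (GroupLieAlgebra 𝓘(ℝ, E) D)}
  {𝒢 𝒢' : LieSubalgebra ℝ (GroupLieAlgebra 𝓘(ℝ, E) D)}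
  {R Rs R' Rs' : GroupLieAlgebra 𝓘(ℝ, E) D →ₗ.[ℝ] GroupLieAlgebra 𝓘(ℝ, E) D} {ι : F →* D}

theorem IsDrinfeldDouble.isLagrangianPair (hD : IsDrinfeldDouble form 𝒢 𝒢') :
    IsLagrangianPair form 𝒢.toSubmodule 𝒢'.toSubmodule :=
  ⟨hD.symm, hD.nondegenerate, hD.isCompl, hD.isotropic, hD.isotropic'⟩

variable [FiniteDimensional ℝ E]

instance finiteDimensional_groupLieAlgebra : FiniteDimensional ℝ (GroupLieAlgebra 𝓘(ℝ, E) D) :=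
  inferInstanceAs (FiniteDimensional ℝ E)

namespace IsDrinfeldDouble

variable (hD : IsDrinfeldDouble form 𝒢 𝒢')
  (hR : OperatorHypotheses form 𝒢.toSubmodule 𝒢'.toSubmodule R Rs R' Rs')
  (h_int : ∀ f : F, IntertwiningIdentity
    (𝒢.toSubmodule.projection 𝒢'.toSubmodule hD.isCompl)
    (𝒢'.toSubmodule.projection 𝒢.toSubmodule hD.isCompl.symm) R (Ad E (ι f)))
  (h_int' : ∀ f : F, IntertwiningIdentity
    (𝒢'.toSubmodule.projection 𝒢.toSubmodule hD.isCompl.symm)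
    (𝒢.toSubmodule.projection 𝒢'.toSubmodule hD.isCompl) R' (Ad E (ι f)))

include hR h_int h_int'

theorem Ad_mem_opKer (f : F) {X : GroupLieAlgebra 𝓘(ℝ, E) D} (hX : X ∈ opKer R) :
    Ad E (ι f) X ∈ opKer R :=
  hR.map_mem_opKer hD.isCompl hD.isLagrangianPair (isAdjointPair_Ad hD.invariant_Ad f) (h_int f)
    (h_int f⁻¹) (h_int' f⁻¹) hX

theorem Ad_mem_opKer' (f : F) {X : GroupLieAlgebra 𝓘(ℝ, E) D} (hX : X ∈ opKer R') :
    Ad E (ι f) X ∈ opKer R' :=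
  hR.swap.map_mem_opKer hD.isCompl.symm hD.isLagrangianPair.swap
    (isAdjointPair_Ad hD.invariant_Ad f) (h_int' f) (h_int' f⁻¹) (h_int f⁻¹) hX

theorem Ad_mem_spaceR (f : F) {X : GroupLieAlgebra 𝓘(ℝ, E) D} (hX : X ∈ spaceR R R') :
    Ad E (ι f) X ∈ spaceR R R' :=
  hR.map_mem_spaceR hD.isCompl (h_int f) (fun _ => hD.Ad_mem_opKer' hR h_int h_int' f) hX

theorem Ad_mem_spaceRPerp (f : F) {X : GroupLieAlgebra 𝓘(ℝ, E) D} (hX : X ∈ spaceRPerp Rs R') :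
    Ad E (ι f) X ∈ spaceRPerp Rs R' :=
  hR.map_mem_spaceRPerp hD.isLagrangianPair (isAdjointPair_Ad hD.invariant_Ad f)
    (fun _ => hD.Ad_mem_spaceR hR h_int h_int' f⁻¹) hX

theorem quadK_add_Ad (f : F) {X Y : GroupLieAlgebra 𝓘(ℝ, E) D}
    (hX : X ∈ form.orthogonal (spaceF R Rs R')) (hY : Y ∈ spaceF R Rs R') :
    quadK form R Rs R' (Y + Ad E (ι f) X) = quadK form R Rs R' X := by
  rw [hR.orthogonal_spaceF hD.isLagrangianPair] at hX
  exact hR.quadK_add_map hD.isLagrangianPair (hD.invariant_Ad (ι f))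
    (fun _ => hD.Ad_mem_spaceR hR h_int h_int' f) (fun _ => hD.Ad_mem_spaceRPerp hR h_int h_int' f)
    hX hY

theorem isGaugeGroup {E₁ : Type*} [NormedAddCommGroup E₁] [NormedSpace ℝ E₁]
    [TopologicalSpace F] [ChartedSpace E₁ F] (hι : ContMDiff 𝓘(ℝ, E₁) 𝓘(ℝ, E) ∞ ι)
    (hιF : ∀ Y : GroupLieAlgebra 𝓘(ℝ, E₁) F,
      mfderiv 𝓘(ℝ, E₁) 𝓘(ℝ, E) ι 1 Y ∈ spaceF R Rs R') :
    IsGaugeGroup (E₁ := E₁) form ι (spaceF R Rs R') where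
  symm := hD.symm
  invariant_Ad := hD.invariant_Ad
  invariant_ad := hD.invariant_ad
  contMDiff := hι
  mfderiv_mem := hιF
  isotropic _ hX _ hY := hR.spaceF_isotropic hD.isLagrangianPair hX hY
  adjoint_mem f _ hX := ⟨hD.Ad_mem_spaceR hR h_int h_int' f hX.1,
    hD.Ad_mem_spaceRPerp hR h_int h_int' f hX.2⟩

end IsDrinfeldDouble

end DressingCoset

end DressingCosets

end

open DressingCosets in
theorem theorem5_general
    {E : Type*} [NormedAddCommGroup E] [NormedSpace ℝ E] [FiniteDimensional ℝ E] [CompleteSpace E]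
    {D : Type*} [TopologicalSpace D] [ChartedSpace E D] [Group D] [LieGroup 𝓘(ℝ, E) ∞ D]
    {E₁ : Type*} [NormedAddCommGroup E₁] [NormedSpace ℝ E₁]
    {F : Type*} [TopologicalSpace F] [ChartedSpace E₁ F] [Group F] [LieGroup 𝓘(ℝ, E₁) ∞ F]
    (form : LinearMap.BilinForm ℝ (GroupLieAlgebra 𝓘(ℝ, E) D))
    (𝒢 𝒢' : LieSubalgebra ℝ (GroupLieAlgebra 𝓘(ℝ, E) D))
    (hD : IsDrinfeldDouble form 𝒢 𝒢')
    (R Rs R' Rs' : GroupLieAlgebra 𝓘(ℝ, E) D →ₗ.[ℝ] GroupLieAlgebra 𝓘(ℝ, E) D)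
    (hR : OperatorHypotheses form 𝒢.toSubmodule 𝒢'.toSubmodule R Rs R' Rs')
    (ι : F →* D) (hι : ContMDiff 𝓘(ℝ, E₁) 𝓘(ℝ, E) ∞ ι)
    (hιF : ∀ Y : GroupLieAlgebra 𝓘(ℝ, E₁) F,
      mfderiv 𝓘(ℝ, E₁) 𝓘(ℝ, E) ι 1 Y ∈ spaceF R Rs R')
    (h_int : ∀ f : F, IntertwiningIdentity
      (𝒢.toSubmodule.projection 𝒢'.toSubmodule hD.isCompl)
      (𝒢'.toSubmodule.projection 𝒢.toSubmodule hD.isCompl.symm) R (Ad E (ι f)))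
    (h_int' : ∀ f : F, IntertwiningIdentity
      (𝒢'.toSubmodule.projection 𝒢.toSubmodule hD.isCompl.symm)
      (𝒢.toSubmodule.projection 𝒢'.toSubmodule hD.isCompl) R' (Ad E (ι f)))
    (b : D → E [⋀^Fin 2]→L[ℝ] ℝ) (hb : IsWZPrimitive form b) :
    (∀ X ∈ form.orthogonal (spaceF R Rs R'),
      (∃ αp αm : R.domain, IsDecomposition R Rs R' X αp αm) ∧
      ∀ αp αm : R.domain, IsDecomposition R Rs R' X αp αm →
        quadK form R Rs R' X = 2 * form αp (R αp) + 2 * form αm (R αm)) ∧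
    (∀ f : F, (∀ X ∈ opKer R, Ad E (ι f) X ∈ opKer R) ∧
      ∀ X ∈ opKer R', Ad E (ι f) X ∈ opKer R') ∧
    ∀ (U W : Set (ℝ × ℝ)), IsOpen U → IsCompact W → W ⊆ U →
      ∀ f : ℝ × ℝ → F, IsGaugeTransformation (E₁ := E₁) U W f →
      ∀ l : ℝ × ℝ → D, ContMDiffOn 𝓘(ℝ, ℝ × ℝ) 𝓘(ℝ, E) ∞ l U →
      ∀ Λ : ℝ × ℝ → E, ContDiffOn ℝ ∞ Λ U → (∀ x ∈ U, Λ x ∈ spaceF R Rs R') →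
        (∀ x ∈ U, gaugeMultiplier ι f Λ x ∈ spaceF R Rs R') ∧
        (∀ x ∈ U, dσ E (gaugeField ι f l) x ∈ form.orthogonal (spaceF R Rs R') ↔
          dσ E l x ∈ form.orthogonal (spaceF R Rs R')) ∧
        (IntegrableOn (lagrangian form b (fun _ => 0) l Λ) W ∧
          IntegrableOn (lagrangian form b (fun _ => 0) (gaugeField ι f l)
            (gaugeMultiplier ι f Λ)) W ∧
          action form b (fun _ => 0) W (gaugeField ι f l) (gaugeMultiplier ι f Λ) =
            action form b (fun _ => 0) W l Λ) ∧
        ((∀ x ∈ U, dσ E l x ∈ form.orthogonal (spaceF R Rs R')) →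
          IntegrableOn (lagrangian form b (quadK form R Rs R') l Λ) W ∧
          IntegrableOn (lagrangian form b (quadK form R Rs R') (gaugeField ι f l)
            (gaugeMultiplier ι f Λ)) W ∧
          action form b (quadK form R Rs R') W (gaugeField ι f l) (gaugeMultiplier ι f Λ) =
            action form b (quadK form R Rs R') W l Λ) := by
  have hP := hD.isLagrangianPair
  have hG := hD.isGaugeGroup hR h_int h_int' hι hιF
  refine ⟨fun X hX => ⟨hR.exists_isDecomposition hP hX,
      fun _ _ => hR.quadK_eq_of_isDecomposition hP⟩,
    fun f => ⟨fun _ => hD.Ad_mem_opKer hR h_int h_int' f,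
      fun _ => hD.Ad_mem_opKer' hR h_int h_int' f⟩, ?_⟩
  intro U W hU hW hWU f hf l hl Λ hΛ hΛF
  have hfAt := fun x hx => hf.contMDiffOn.contMDiffAt (x := x) (hU.mem_nhds hx)
  have hlAt := fun x hx => hl.contMDiffAt (x := x) (hU.mem_nhds hx)
  refine ⟨fun x hx => gaugeMultiplier_mem hG (hfAt x hx) (hΛF x hx),
    fun x hx => dσ_gaugeField_mem_orthogonal_iff hG (hfAt x hx) (hlAt x hx), ?_, fun hσ => ?_⟩
  · exact action_gauge_eq hG hb hU hW hWU hf hl hΛ.continuousOn hΛF continuousOn_const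
      fun _ _ _ _ _ => rfl
  · have hdσ : ContinuousOn (fun x => rightDeriv E l x (0, 1)) U := fun x hx =>
      (continuousAt_rightDeriv_apply (hlAt x hx) (0, 1)).continuousWithinAt
    exact action_gauge_eq hG hb hU hW hWU hf hl hΛ.continuousOn hΛF
      ((hR.continuousOn_quadK (E := E) hP).comp hdσ hσ)
      fun x hx f _ hY => hD.quadK_add_Ad hR h_int h_int' f (hσ x hx) hY

open DressingCosets in
theorem theorem5
    {E : Type*} [NormedAddCommGroup E] [NormedSpace ℝ E] [FiniteDimensional ℝ E] [CompleteSpace E]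
    {D : Type*} [TopologicalSpace D] [ChartedSpace E D] [Group D] [LieGroup 𝓘(ℝ, E) ∞ D]
    {E₁ : Type*} [NormedAddCommGroup E₁] [NormedSpace ℝ E₁] [FiniteDimensional ℝ E₁]
    {F : Type*} [TopologicalSpace F] [ChartedSpace E₁ F] [Group F] [LieGroup 𝓘(ℝ, E₁) ∞ F]
    [ConnectedSpace F]
    (form : LinearMap.BilinForm ℝ (GroupLieAlgebra 𝓘(ℝ, E) D))
    (𝒢 𝒢' : LieSubalgebra ℝ (GroupLieAlgebra 𝓘(ℝ, E) D))
    (hD : IsDrinfeldDouble form 𝒢 𝒢')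
    (R Rs R' Rs' : GroupLieAlgebra 𝓘(ℝ, E) D →ₗ.[ℝ] GroupLieAlgebra 𝓘(ℝ, E) D)
    (hR : OperatorHypotheses form 𝒢.toSubmodule 𝒢'.toSubmodule R Rs R' Rs')
    (hF_lie : ∀ X ∈ spaceF R Rs R', ∀ Y ∈ spaceF R Rs R', ⁅X, Y⁆ ∈ spaceF R Rs R')
    (ι : F →* D) (hF : IsLieSubgroup (E₁ := E₁) ι (spaceF R Rs R'))
    (h_int : ∀ f : F, IntertwiningIdentity
      (𝒢.toSubmodule.projection 𝒢'.toSubmodule hD.isCompl)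
      (𝒢'.toSubmodule.projection 𝒢.toSubmodule hD.isCompl.symm) R (Ad E (ι f)))
    (h_int' : ∀ f : F, IntertwiningIdentity
      (𝒢'.toSubmodule.projection 𝒢.toSubmodule hD.isCompl.symm)
      (𝒢.toSubmodule.projection 𝒢'.toSubmodule hD.isCompl) R' (Ad E (ι f)))
    (b : D → E [⋀^Fin 2]→L[ℝ] ℝ) (hb : IsWZPrimitive form b) :
    -- the quadratic form is well defined on the orthogonal of `ℱ`
    (∀ X ∈ form.orthogonal (spaceF R Rs R'),
      (∃ αp αm : R.domain, IsDecomposition R Rs R' X αp αm) ∧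
      ∀ αp αm : R.domain, IsDecomposition R Rs R' X αp αm →
        quadK form R Rs R' X = 2 * form αp (R αp) + 2 * form αm (R αm)) ∧
    -- the adjoint action of `F` preserves the kernels
    (∀ f : F, (∀ X ∈ opKer R, Ad E (ι f) X ∈ opKer R) ∧
      ∀ X ∈ opKer R', Ad E (ι f) X ∈ opKer R') ∧
    -- gauge symmetry
    ∀ (U W : Set (ℝ × ℝ)), IsOpen U → IsCompact W → W ⊆ U →
      ∀ f : ℝ × ℝ → F, IsGaugeTransformation (E₁ := E₁) U W f →
      ∀ l : ℝ × ℝ → D, ContMDiffOn 𝓘(ℝ, ℝ × ℝ) 𝓘(ℝ, E) ∞ l U →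
      ∀ Λ : ℝ × ℝ → E, ContDiffOn ℝ ∞ Λ U → (∀ x ∈ U, Λ x ∈ spaceF R Rs R') →
        -- the gauge transforms are fields of the same kind
        (∀ x ∈ U, gaugeMultiplier ι f Λ x ∈ spaceF R Rs R') ∧
        (∀ x ∈ U, dσ E (gaugeField ι f l) x ∈ form.orthogonal (spaceF R Rs R') ↔
          dσ E l x ∈ form.orthogonal (spaceF R Rs R')) ∧
        -- the action without `K` is invariant for all fields
        (IntegrableOn (lagrangian form b (fun _ => 0) l Λ) W ∧
          IntegrableOn (lagrangian form b (fun _ => 0) (gaugeField ι f l)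
            (gaugeMultiplier ι f Λ)) W ∧
          action form b (fun _ => 0) W (gaugeField ι f l) (gaugeMultiplier ι f Λ) =
            action form b (fun _ => 0) W l Λ) ∧
        -- the action is invariant for the fields that satisfy the constraint
        ((∀ x ∈ U, dσ E l x ∈ form.orthogonal (spaceF R Rs R')) →
          IntegrableOn (lagrangian form b (quadK form R Rs R') l Λ) W ∧
          IntegrableOn (lagrangian form b (quadK form R Rs R') (gaugeField ι f l)
            (gaugeMultiplier ι f Λ)) W ∧
          action form b (quadK form R Rs R') W (gaugeField ι f l) (gaugeMultiplier ι f Λ) =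
            action form b (quadK form R Rs R') W l Λ) :=
  theorem5_general form 𝒢 𝒢' hD R Rs R' Rs' hR ι hF.smooth
    (fun Y => (hF.range_deriv _).2 ⟨Y, rfl⟩) h_int h_int' b hb
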